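/- Conventions. All tensor products of unital C*-algebras are maximal: for a nonempty, finite or infinite, family $(A_i)$ of unital C*-algebras, $\bigotimes_i A_i$ is the universal C*-algebra generated by pairwise commuting copies of the $A_i$ with a common unit. A "copy" of $A_i$ is the image of a *-homomorphism on $A_i$. Write $P^{\otimes\infty}=\bigotimes_{k=1}^{\infty}P$, and regard $A\otimes P^{\otimes\infty}$ as the universal C*-algebra generated by a copy of $A$ and a sequence of copies of $P$ which commute pairwise and have a common unit. A separable C*-algebra $A$ is semiprojective if, whenever $D$ is a C*-algebra, $(J_n)$ is an increasing sequence of closed two-sided ideals of $D$ and $J=\overline{\bigcup_n J_n}$, every *-homomorphism $\phi:A\to D/J$ lifts, for some $n$, to a *-homomorphism $\psi:A\to D/J_n$ (i.e. the composition of $\psi$ with the quotient map $D/J_n\to D/J$ is $\phi$). Theorem. Let $A$ and $P$ be separable unital C*-algebras such that $P\cong P^{\otimes\infty}$, $A$ is semiprojective, and $A\otimes P\cong A$. Let $Q$ be the full (non-unital) free product of $A$ and a sequence of copies of $P$, i.e. the universal C*-algebra generated by a copy of $A$ and a sequence of copies of $P$ with no relations. Let $\pi:Q\to A\otimes P^{\otimes\infty}$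 be the canonical quotient map, which sends the copy of $A$ and the $k$-th copy of $P$ in $Q$ identically to the copy of $A$ and the $k$-th copy of $P$ in $A\otimes P^{\otimes\infty}$. Then $\pi$ splits: there is a (not necessarily unital) *-homomorphism $\sigma:A\otimes P^{\otimes\infty}\to Q$ with $\pi\circ\sigma=\mathrm{id}$. -/

import Mathlib

open UniformSpace TopologicalSpace

universe u v w

noncomputable section

/-! ## C⋆-completions -/

/-- A pre-C⋆-algebra: a complex ⋆-algebra with a submultiplicative seminorm satisfying the
C⋆-identity. -/
class PreCStarAlgebra (F : Type*) extends NonUnitalSeminormedRing F, StarRing F, NormedSpace ℂ F,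
    IsScalarTower ℂ F F, SMulCommClass ℂ F F, StarModule ℂ F where
  norm_mul_self_le : ∀ x : F, ‖x‖ * ‖x‖ ≤ ‖star x * x‖

namespace PreCStarAlgebra

variable {F : Type*} [PreCStarAlgebra F]

theorem norm_le_norm_star (x : F) : ‖x‖ ≤ ‖star x‖ := by
  by_contra! h
  have h1 := norm_mul_self_le x
  have h2 := norm_mul_le (star x) x
  nlinarith [norm_nonneg (star x)]

theorem norm_star' (x : F) : ‖star x‖ = ‖x‖ :=
  le_antisymm (by simpa using norm_le_norm_star (star x)) (norm_le_norm_star x)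

theorem isometry_star : Isometry (star : F → F) :=
  AddMonoidHomClass.isometry_of_norm (starAddEquiv : F ≃+ F) norm_star'

instance instMulCompletion : Mul (Completion F) :=
  ⟨Function.curry <| (Completion.isDenseInducing_coe.prodMap Completion.isDenseInducing_coe).extend
    ((↑) ∘ Function.uncurry (· * ·))⟩

theorem coe_mul (a b : F) : ((a * b : F) : Completion F) = a * b :=
  ((Completion.isDenseInducing_coe.prodMap Completion.isDenseInducing_coe).extend_eq
      ((Completion.continuous_coe F).comp (@continuous_mul F _ _ _)) (a, b)).symm

instance instContinuousMulCompletion : ContinuousMul (Completion F) where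
  continuous_mul := by
    let m := (AddMonoidHom.mul : F →+ F →+ F).compr₂ Completion.toCompl
    have : Continuous fun p : F × F => m p.1 p.2 :=
      (Completion.continuous_coe F).comp continuous_mul
    have di : IsDenseInducing (Completion.toCompl : F → Completion F) :=
      Completion.isDenseInducing_coe
    exact (di.extend_Z_bilin di this :)

instance instStarCompletion : Star (Completion F) := ⟨Completion.map star⟩

theorem coe_star (a : F) : ((star a : F) : Completion F) = star (a : Completion F) :=
  (Completion.map_coe isometry_star.uniformContinuous a).symm

instance instContinuousStarCompletion : ContinuousStar (Completion F) :=
  ⟨Completion.continuous_map⟩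

instance instNonUnitalNormedRingCompletion : NonUnitalNormedRing (Completion F) where
  __ : NormedAddCommGroup (Completion F) := inferInstance
  __ : Mul (Completion F) := inferInstance
  zero_mul a := by
    induction a using Completion.induction_on with
    | hp => exact isClosed_eq (by fun_prop) (by fun_prop)
    | ih a => rw [← Completion.coe_zero, ← coe_mul, zero_mul]
  mul_zero a := by
    induction a using Completion.induction_on with
    | hp => exact isClosed_eq (by fun_prop) (by fun_prop)
    | ih a => rw [← Completion.coe_zero, ← coe_mul, mul_zero]
  mul_assoc a b c := by
    induction a, b, c using Completion.induction_on₃ with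
    | hp => exact isClosed_eq (by fun_prop) (by fun_prop)
    | ih a b c => simp only [← coe_mul, mul_assoc]
  left_distrib a b c := by
    induction a, b, c using Completion.induction_on₃ with
    | hp => exact isClosed_eq (by fun_prop) (by fun_prop)
    | ih a b c => simp only [← coe_mul, ← Completion.coe_add, mul_add]
  right_distrib a b c := by
    induction a, b, c using Completion.induction_on₃ with
    | hp => exact isClosed_eq (by fun_prop) (by fun_prop)
    | ih a b c => simp only [← coe_mul, ← Completion.coe_add, add_mul]
  norm_mul_le a b := by
    induction a, b using Completion.induction_on₂ with
    | hp => exact isClosed_le (by fun_prop) (by fun_prop)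
    | ih a b => simpa only [← coe_mul, Completion.norm_coe] using norm_mul_le a b

instance instStarRingCompletion : StarRing (Completion F) where
  star_involutive a := by
    induction a using Completion.induction_on with
    | hp => exact isClosed_eq (by fun_prop) (by fun_prop)
    | ih a => rw [← coe_star, ← coe_star, star_star]
  star_mul a b := by
    induction a, b using Completion.induction_on₂ with
    | hp => exact isClosed_eq (by fun_prop) (by fun_prop)
    | ih a b => simp only [← coe_mul, ← coe_star, star_mul]
  star_add a b := by
    induction a, b using Completion.induction_on₂ with
    | hp => exact isClosed_eq (by fun_prop) (by fun_prop)
    | ih a b => simp only [← Completion.coe_add, ← coe_star, star_add]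

instance instCStarRingCompletion : CStarRing (Completion F) where
  norm_mul_self_le a := by
    induction a using Completion.induction_on with
    | hp => exact isClosed_le (by fun_prop) (by fun_prop)
    | ih a =>
      simpa only [← coe_mul, ← coe_star, Completion.norm_coe] using norm_mul_self_le a

theorem continuous_smul_completion (c : ℂ) : Continuous fun a : Completion F => c • a :=
  Completion.continuous_map

instance instIsScalarTowerCompletion : IsScalarTower ℂ (Completion F) (Completion F) where
  smul_assoc c a b := by
    have h := continuous_smul_completion (F := F) c
    simp only [smul_eq_mul]
    induction a, b using Completion.induction_on₂ with
    | hp =>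
      refine isClosed_eq ?_ ?_
      · exact (h.comp continuous_fst).mul continuous_snd
      · exact h.comp (continuous_fst.mul continuous_snd)
    | ih a b => simp only [← coe_mul, ← Completion.coe_smul, smul_mul_assoc]

instance instSMulCommClassCompletion : SMulCommClass ℂ (Completion F) (Completion F) where
  smul_comm c a b := by
    have h := continuous_smul_completion (F := F) c
    simp only [smul_eq_mul]
    induction a, b using Completion.induction_on₂ with
    | hp =>
      refine isClosed_eq ?_ ?_
      · exact h.comp (continuous_fst.mul continuous_snd)
      · exact continuous_fst.mul (h.comp continuous_snd)
    | ih a b => simp only [← coe_mul, ← Completion.coe_smul, mul_smul_comm]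

instance instStarModuleCompletion : StarModule ℂ (Completion F) where
  star_smul c a := by
    have h := continuous_smul_completion (F := F)
    induction a using Completion.induction_on with
    | hp => exact isClosed_eq (continuous_star.comp (h c)) ((h (star c)).comp continuous_star)
    | ih a => simp only [← coe_star, ← Completion.coe_smul, star_smul]

/-- The completion of a pre-C⋆-algebra (Hausdorff, so null vectors are divided out) is a
C⋆-algebra. -/
instance instCStarCompletion : NonUnitalCStarAlgebra (Completion F) where

/-- Continuous extension of a ⋆-homomorphism to the completion. -/
def extend {D : Type*} [NonUnitalCStarAlgebra D] (φ : F →⋆ₙₐ[ℂ] D) (hu : UniformContinuous φ) :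
    Completion F →⋆ₙₐ[ℂ] D where
  toFun := Completion.extension φ
  map_smul' c a := by
    have hc : Continuous (Completion.extension φ) := Completion.continuous_extension
    induction a using Completion.induction_on with
    | hp =>
      refine isClosed_eq ?_ ?_
      · exact hc.comp (continuous_smul_completion c)
      · exact hc.const_smul c
    | ih a =>
      rw [← Completion.coe_smul, Completion.extension_coe hu, Completion.extension_coe hu, map_smul]
      rfl
  map_zero' := by rw [← Completion.coe_zero, Completion.extension_coe hu, map_zero]
  map_add' a b := by
    have hc : Continuous (Completion.extension φ) := Completion.continuous_extension
    induction a, b using Completion.induction_on₂ with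
    | hp => exact isClosed_eq (by fun_prop) (by fun_prop)
    | ih a b => simp only [← Completion.coe_add, Completion.extension_coe hu, map_add]
  map_mul' a b := by
    have hc : Continuous (Completion.extension φ) := Completion.continuous_extension
    induction a, b using Completion.induction_on₂ with
    | hp => exact isClosed_eq (by fun_prop) (by fun_prop)
    | ih a b => simp only [← coe_mul, Completion.extension_coe hu, map_mul]
  map_star' a := by
    have hc : Continuous (Completion.extension φ) := Completion.continuous_extension
    induction a using Completion.induction_on with
    | hp => exact isClosed_eq (by fun_prop) (by fun_prop)
    | ih a => simp only [← coe_star, Completion.extension_coe hu, map_star]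

theorem extend_coe {D : Type*} [NonUnitalCStarAlgebra D] (φ : F →⋆ₙₐ[ℂ] D)
    (hu : UniformContinuous φ) (a : F) : extend φ hu (a : Completion F) = φ a :=
  Completion.extension_coe hu a

end PreCStarAlgebra

/-! ## The free ⋆-algebra -/

namespace FreeStar

variable {X : Type u}

/-- Nonempty words in the letters `Sum.inl x`, standing for `x`, and `Sum.inr x`, standing for
`x⋆`. -/
abbrev Word (X : Type u) : Type u := FreeSemigroup (X ⊕ X)

/-- The formal adjoint of a word: reverse it and exchange `x` and `x⋆`. -/
def wordStar : Word X →ₙ* (Word X)ᵐᵒᵖ :=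
  FreeSemigroup.lift fun s => MulOpposite.op (FreeSemigroup.of s.swap)

theorem wordStar_of (s : X ⊕ X) :
    (wordStar (FreeSemigroup.of s)).unop = FreeSemigroup.of s.swap := rfl

theorem wordStar_mul (a b : Word X) :
    (wordStar (a * b)).unop = (wordStar b).unop * (wordStar a).unop := by
  rw [map_mul, MulOpposite.unop_mul]

theorem wordStar_wordStar (a : Word X) : (wordStar (wordStar a).unop).unop = a := by
  induction a using FreeSemigroup.recOnMul with
  | ih1 s => simp [wordStar_of]
  | ih2 s b h1 h2 => rw [wordStar_mul, wordStar_mul, h1, h2]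

end FreeStar

/-- The free (non-unital, associative) complex ⋆-algebra on the set `X`: non-commutative
⋆-polynomials without constant term. -/
def FreeStarAlgebra (X : Type u) : Type u := MonoidAlgebra ℂ (FreeStar.Word X)

namespace FreeStarAlgebra

open FreeStar

variable {X : Type u}

instance : NonUnitalRing (FreeStarAlgebra X) :=
  inferInstanceAs (NonUnitalRing (MonoidAlgebra ℂ (Word X)))

instance : Module ℂ (FreeStarAlgebra X) :=
  inferInstanceAs (Module ℂ (MonoidAlgebra ℂ (Word X)))

instance : IsScalarTower ℂ (FreeStarAlgebra X) (FreeStarAlgebra X) :=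
  inferInstanceAs (IsScalarTower ℂ (MonoidAlgebra ℂ (Word X)) (MonoidAlgebra ℂ (Word X)))

instance : SMulCommClass ℂ (FreeStarAlgebra X) (FreeStarAlgebra X) :=
  inferInstanceAs (SMulCommClass ℂ (MonoidAlgebra ℂ (Word X)) (MonoidAlgebra ℂ (Word X)))

/-- The monomial `c • w`. -/
def monomial (w : Word X) (c : ℂ) : FreeStarAlgebra X := MonoidAlgebra.single w c

/-- The generator `x`. -/
def of (x : X) : FreeStarAlgebra X := monomial (FreeSemigroup.of (Sum.inl x)) 1

theorem induction_linear {motive : FreeStarAlgebra X → Prop} (x : FreeStarAlgebra X)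
    (zero : motive 0) (add : ∀ x y, motive x → motive y → motive (x + y))
    (monomial : ∀ w c, motive (monomial w c)) : motive x :=
  MonoidAlgebra.induction_linear (motive := motive) x zero add monomial

theorem monomial_mul (w w' : Word X) (c c' : ℂ) :
    monomial w c * monomial w' c' = monomial (w * w') (c * c') :=
  MonoidAlgebra.single_mul_single ..

theorem smul_monomial (w : Word X) (c c' : ℂ) :
    c • monomial w c' = monomial w (c * c') :=
  MonoidAlgebra.smul_single ..

/-- The conjugate-linear anti-multiplicative extension of `wordStar`. -/
def starHom : FreeStarAlgebra X →+ FreeStarAlgebra X :=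
  (Finsupp.liftAddHom fun w : Word X =>
    ((MonoidAlgebra.singleAddHom (wordStar w).unop).comp
      (starRingEnd ℂ).toAddMonoidHom : ℂ →+ MonoidAlgebra ℂ (Word X))).comp
    (MonoidAlgebra.coeffAddEquiv (R := ℂ) (M := Word X)).toAddMonoidHom

instance : Star (FreeStarAlgebra X) := ⟨starHom⟩

theorem star_monomial (w : Word X) (c : ℂ) :
    star (monomial w c) = monomial (wordStar w).unop (star c) := by
  change starHom (MonoidAlgebra.single w c) = MonoidAlgebra.single (wordStar w).unop (star c)
  change (Finsupp.liftAddHom fun w : Word X =>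
    ((MonoidAlgebra.singleAddHom (wordStar w).unop).comp
      (starRingEnd ℂ).toAddMonoidHom : ℂ →+ MonoidAlgebra ℂ (Word X))) (Finsupp.single w c) = _
  rw [Finsupp.liftAddHom_apply_single]
  rfl

theorem star_add' (x y : FreeStarAlgebra X) : star (x + y) = star x + star y :=
  map_add starHom x y

theorem star_zero' : star (0 : FreeStarAlgebra X) = 0 := map_zero starHom

instance : StarRing (FreeStarAlgebra X) where
  star_involutive x := by
    induction x using induction_linear with
    | zero => rw [star_zero', star_zero']
    | add x y hx hy => rw [star_add', star_add', hx, hy]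
    | monomial w c => rw [star_monomial, star_monomial, wordStar_wordStar, star_star]
  star_add := star_add'
  star_mul x y := by
    induction x using induction_linear with
    | zero => simp [star_zero']
    | add x x' hx hx' => rw [add_mul, star_add', hx, hx', star_add', mul_add]
    | monomial w c =>
      induction y using induction_linear with
      | zero => simp [star_zero']
      | add y y' hy hy' => rw [mul_add, star_add', hy, hy', star_add', add_mul]
      | monomial w' c' =>
        simp only [monomial_mul, star_monomial, wordStar_mul, star_mul]

instance : StarModule ℂ (FreeStarAlgebra X) where
  star_smul c x := by
    induction x using induction_linear with
    | zero => simp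
    | add x y hx hy => simp only [smul_add, star_add, hx, hy]
    | monomial w c' => simp [smul_monomial, star_monomial]

section Lift

set_option linter.unusedSectionVars false

variable {D : Type*} [NonUnitalRing D] [StarRing D] [Module ℂ D] [IsScalarTower ℂ D D]
  [SMulCommClass ℂ D D] [StarModule ℂ D]

/-- Evaluation of words, sending `x` to `f x` and `x⋆` to `star (f x)`. -/
def wordLift (f : X → D) : Word X →ₙ* D :=
  FreeSemigroup.lift (Sum.elim f fun x => star (f x))

theorem wordLift_wordStar (f : X → D) (w : Word X) :
    wordLift f (wordStar w).unop = star (wordLift f w) := by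
  induction w using FreeSemigroup.recOnMul with
  | ih1 s => cases s <;> simp [wordStar_of, wordLift]
  | ih2 s b h1 h2 => rw [wordStar_mul, map_mul, map_mul, star_mul, h1, h2]

/-- Evaluation of the ⋆-polynomials at a family `f` in a ⋆-algebra, as a linear multiplicative
map. -/
def liftAux (f : X → D) : FreeStarAlgebra X →ₙₐ[ℂ] D :=
  MonoidAlgebra.liftMagma ℂ (wordLift f)

theorem liftAux_monomial (f : X → D) (w : Word X) (c : ℂ) :
    liftAux f (monomial w c) = c • wordLift f w := by
  change MonoidAlgebra.liftMagma ℂ (wordLift f) (MonoidAlgebra.single w c) = _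
  rw [MonoidAlgebra.liftMagma_apply_apply]
  exact Finsupp.sum_single_index (zero_smul ℂ _)

/-- Evaluation of the ⋆-polynomials at a family `f` in a ⋆-algebra, as a ⋆-homomorphism. -/
def lift (f : X → D) : FreeStarAlgebra X →⋆ₙₐ[ℂ] D where
  __ := liftAux f
  map_star' x := by
    change liftAux f (star x) = star (liftAux f x)
    induction x using induction_linear with
    | zero => simp
    | add x y hx hy => simp only [star_add, map_add, hx, hy]
    | monomial w c => simp [star_monomial, liftAux_monomial, wordLift_wordStar]

@[simp]
theorem lift_of (f : X → D) (x : X) : lift f (of x) = f x := by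
  change liftAux f (monomial _ 1) = _
  rw [liftAux_monomial, one_smul]
  rfl

theorem hom_ext {φ ψ : FreeStarAlgebra X →⋆ₙₐ[ℂ] D} (h : ∀ x, φ (of x) = ψ (of x)) (a) :
    φ a = ψ a := by
  induction a using induction_linear with
  | zero => simp
  | add x y hx hy => simp only [map_add, hx, hy]
  | monomial w c =>
    rw [← mul_one c, ← smul_monomial, map_smul, map_smul]
    congr 1
    induction w using FreeSemigroup.recOnMul with
    | ih1 s =>
      rcases s with x | x
      · exact h x
      · have : monomial (FreeSemigroup.of (Sum.inr x)) 1 = star (of x) := by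
          simp [of, star_monomial, wordStar_of]
        rw [this, map_star, map_star, h]
    | ih2 s b h1 h2 =>
      rw [← mul_one (1 : ℂ), ← monomial_mul, map_mul, map_mul, h1, h2]

end Lift

end FreeStarAlgebra

/-! ## Universal C⋆-algebras given by generators and relations -/

/-- Generators `X`, a bound for the norm of each generator, and relations `r = 0` for ⋆-polynomials
`r` in the generators. -/
structure CStarPresentation (X : Type u) where
  bound : X → NNReal
  rels : Set (FreeStarAlgebra X)

/-- A C⋆-seminorm on a complex ⋆-algebra. -/
structure CStarSeminorm (F : Type*) [NonUnitalRing F] [StarRing F] [Module ℂ F] extends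
    Seminorm ℂ F where
  mul_le' : ∀ x y, toFun (x * y) ≤ toFun x * toFun y
  star_mul_self' : ∀ x, toFun (star x * x) = toFun x ^ 2

namespace CStarPresentation

variable {X : Type u} (G : CStarPresentation X)

/-- The C⋆-seminorms on the free ⋆-algebra that respect the bounds and the relations. -/
def Admissible : Type u :=
  {p : CStarSeminorm (FreeStarAlgebra X) //
    (∀ x, p.toSeminorm (FreeStarAlgebra.of x) ≤ G.bound x) ∧ ∀ r ∈ G.rels, p.toSeminorm r = 0}

variable {G} in
/-- The underlying seminorm. -/
def Admissible.toSeminorm (p : G.Admissible) : Seminorm ℂ (FreeStarAlgebra X) := p.1.toSeminorm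

namespace Admissible

variable {G} (p : G.Admissible)

theorem mul_le (x y : FreeStarAlgebra X) :
    p.toSeminorm (x * y) ≤ p.toSeminorm x * p.toSeminorm y := p.1.mul_le' x y

theorem star_mul_self (x : FreeStarAlgebra X) :
    p.toSeminorm (star x * x) = p.toSeminorm x ^ 2 := p.1.star_mul_self' x

theorem le_star (x : FreeStarAlgebra X) : p.toSeminorm x ≤ p.toSeminorm (star x) := by
  by_contra! h
  have h1 := p.star_mul_self x
  have h2 := p.mul_le (star x) x
  nlinarith [apply_nonneg p.toSeminorm (star x)]

theorem map_star (x : FreeStarAlgebra X) : p.toSeminorm (star x) = p.toSeminorm x :=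
  le_antisymm (by simpa using p.le_star (star x)) (p.le_star x)

end Admissible

instance : Nonempty G.Admissible :=
  ⟨⟨{ (0 : Seminorm ℂ (FreeStarAlgebra X)) with
      mul_le' := fun _ _ => (mul_zero (0 : ℝ)).ge
      star_mul_self' := fun _ => (zero_pow (M₀ := ℝ) two_ne_zero).symm }, fun x => (G.bound x).2, fun _ _ => rfl⟩⟩

open FreeStarAlgebra in
theorem bddAbove (x : FreeStarAlgebra X) :
    BddAbove (Set.range fun p : G.Admissible => p.toSeminorm x) := by
  suffices h : ∃ C, ∀ p : G.Admissible, p.toSeminorm x ≤ C by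
    obtain ⟨C, hC⟩ := h
    exact ⟨C, by rintro _ ⟨p, rfl⟩; exact hC p⟩
  induction x using induction_linear with
  | zero => exact ⟨0, fun p => by simp⟩
  | add x y hx hy =>
    obtain ⟨C, hC⟩ := hx
    obtain ⟨C', hC'⟩ := hy
    exact ⟨C + C', fun p => (map_add_le_add _ _ _).trans (add_le_add (hC p) (hC' p))⟩
  | monomial w c =>
    suffices h : ∃ C, ∀ p : G.Admissible, p.toSeminorm (monomial w 1) ≤ C by
      obtain ⟨C, hC⟩ := h
      refine ⟨‖c‖ * C, fun p => ?_⟩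
      rw [← mul_one c, ← smul_monomial, map_smul_eq_mul, mul_one]
      exact mul_le_mul_of_nonneg_left (hC p) (norm_nonneg c)
    induction w using FreeSemigroup.recOnMul with
    | ih1 s =>
      rcases s with x | x
      · exact ⟨G.bound x, fun p => p.2.1 x⟩
      · have : monomial (FreeSemigroup.of (Sum.inr x)) 1 = star (of x) := by
          simp [of, star_monomial, FreeStar.wordStar_of]
        refine ⟨G.bound x, fun p => ?_⟩
        rw [this, p.map_star]
        exact p.2.1 x
    | ih2 s b h1 h2 =>
      obtain ⟨C, hC⟩ := h1
      obtain ⟨C', hC'⟩ := h2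
      refine ⟨C * C', fun p => ?_⟩
      rw [← mul_one (1 : ℂ), ← monomial_mul]
      exact (p.mul_le _ _).trans (mul_le_mul (hC p) (hC' p) (apply_nonneg _ _)
        ((apply_nonneg _ _).trans (hC p)))

/-- The free ⋆-algebra on `X`, equipped with the largest C⋆-seminorm that respects the bounds and
the relations of `G`. -/
def Pre (_ : CStarPresentation X) : Type u := FreeStarAlgebra X

instance : NonUnitalRing G.Pre := inferInstanceAs (NonUnitalRing (FreeStarAlgebra X))
instance : StarRing G.Pre := inferInstanceAs (StarRing (FreeStarAlgebra X))
instance : Module ℂ G.Pre := inferInstanceAs (Module ℂ (FreeStarAlgebra X))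

/-- The largest admissible C⋆-seminorm. -/
def univNorm (x : FreeStarAlgebra X) : ℝ := ⨆ p : G.Admissible, p.toSeminorm x

theorem le_univNorm (p : G.Admissible) (x : FreeStarAlgebra X) : p.toSeminorm x ≤ G.univNorm x :=
  le_ciSup (G.bddAbove x) p

theorem univNorm_nonneg (x : FreeStarAlgebra X) : 0 ≤ G.univNorm x :=
  Real.iSup_nonneg fun p => apply_nonneg p.toSeminorm x

theorem univNorm_zero : G.univNorm 0 = 0 := by
  rw [univNorm, iSup_congr fun p : G.Admissible => map_zero p.toSeminorm, ciSup_const]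

theorem univNorm_neg (x : FreeStarAlgebra X) : G.univNorm (-x) = G.univNorm x :=
  iSup_congr fun p : G.Admissible => map_neg_eq_map p.toSeminorm x

theorem univNorm_add_le (x y : FreeStarAlgebra X) :
    G.univNorm (x + y) ≤ G.univNorm x + G.univNorm y :=
  ciSup_le fun p => (map_add_le_add _ _ _).trans
    (add_le_add (G.le_univNorm p x) (G.le_univNorm p y))

theorem univNorm_mul_le (x y : FreeStarAlgebra X) :
    G.univNorm (x * y) ≤ G.univNorm x * G.univNorm y :=
  ciSup_le fun p => (p.mul_le x y).trans
    (mul_le_mul (G.le_univNorm p x) (G.le_univNorm p y) (apply_nonneg _ _) (G.univNorm_nonneg x))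

theorem univNorm_smul_le (c : ℂ) (x : FreeStarAlgebra X) :
    G.univNorm (c • x) ≤ ‖c‖ * G.univNorm x :=
  ciSup_le fun p => by
    rw [map_smul_eq_mul]
    exact mul_le_mul_of_nonneg_left (G.le_univNorm p x) (norm_nonneg c)

theorem univNorm_mul_self_le (x : FreeStarAlgebra X) :
    G.univNorm x * G.univNorm x ≤ G.univNorm (star x * x) := by
  rw [← sq, ← Real.le_sqrt (G.univNorm_nonneg x) (G.univNorm_nonneg _)]
  refine ciSup_le fun p => Real.le_sqrt_of_sq_le ?_
  rw [← p.star_mul_self]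
  exact G.le_univNorm p _

instance : SeminormedAddCommGroup G.Pre :=
  AddGroupSeminorm.toSeminormedAddCommGroup
    { toFun := G.univNorm
      map_zero' := G.univNorm_zero
      add_le' := G.univNorm_add_le
      neg' := G.univNorm_neg }

instance : PreCStarAlgebra G.Pre where
  __ := (inferInstance : SeminormedAddCommGroup G.Pre)
  __ := (inferInstance : NonUnitalRing G.Pre)
  __ := (inferInstance : StarRing G.Pre)
  __ := (inferInstance : Module ℂ G.Pre)
  norm_mul_le := G.univNorm_mul_le
  norm_smul_le := G.univNorm_smul_le
  smul_assoc := smul_assoc (M := ℂ) (N := FreeStarAlgebra X) (α := FreeStarAlgebra X)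
  smul_comm := smul_comm (M := ℂ) (N := FreeStarAlgebra X) (α := FreeStarAlgebra X)
  star_smul := star_smul (R := ℂ) (A := FreeStarAlgebra X)
  norm_mul_self_le := G.univNorm_mul_self_le

/-- The universal C⋆-algebra on the generators and relations of `G`. -/
def UniversalCStar : Type u := Completion G.Pre

instance : NonUnitalCStarAlgebra G.UniversalCStar :=
  inferInstanceAs (NonUnitalCStarAlgebra (Completion G.Pre))

/-- The canonical map of the free ⋆-algebra to the universal C⋆-algebra. -/
def toUniv : FreeStarAlgebra X →⋆ₙₐ[ℂ] G.UniversalCStar where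
  toFun x := ((show G.Pre from x : G.Pre) : Completion G.Pre)
  map_smul' c x := Completion.coe_smul (X := G.Pre) c x
  map_zero' := Completion.coe_zero
  map_add' x y := Completion.coe_add (α := G.Pre) x y
  map_mul' x y := PreCStarAlgebra.coe_mul (F := G.Pre) x y
  map_star' x := PreCStarAlgebra.coe_star (F := G.Pre) x

theorem norm_toUniv (x : FreeStarAlgebra X) : ‖G.toUniv x‖ = G.univNorm x :=
  Completion.norm_coe (E := G.Pre) x

theorem denseRange_toUniv : DenseRange G.toUniv := Completion.denseRange_coe (α := G.Pre)

theorem toUniv_rel {r : FreeStarAlgebra X} (hr : r ∈ G.rels) : G.toUniv r = 0 := by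
  have h (p : G.Admissible) : p.toSeminorm r = 0 := p.2.2 r hr
  rw [← norm_eq_zero, norm_toUniv, univNorm, iSup_congr h, ciSup_const]

section Lift

variable {G} {D : Type v} [NonUnitalCStarAlgebra D]

/-- The C⋆-seminorm induced by a representation of the generators and relations. -/
def admissibleOf (f : X → D) (hb : ∀ x, ‖f x‖ ≤ G.bound x)
    (hr : ∀ r ∈ G.rels, FreeStarAlgebra.lift f r = 0) : G.Admissible :=
  ⟨{ toFun := fun x => ‖FreeStarAlgebra.lift f x‖
     map_zero' := by simp
     add_le' := fun x y => by rw [map_add]; exact norm_add_le _ _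
     neg' := fun x => by rw [map_neg, norm_neg]
     smul' := fun c x => by rw [map_smul, norm_smul]
     mul_le' := fun x y => by rw [map_mul]; exact norm_mul_le _ _
     star_mul_self' := fun x => by
      rw [map_mul, map_star, CStarRing.norm_star_mul_self, sq] },
   fun x => by
    change ‖FreeStarAlgebra.lift f (FreeStarAlgebra.of x)‖ ≤ _
    rw [FreeStarAlgebra.lift_of]; exact hb x,
   fun r h => by
    change ‖FreeStarAlgebra.lift f r‖ = 0
    rw [hr r h, norm_zero]⟩

/-- The evaluation map on the pre-C⋆-algebra. -/
def liftPre (f : X → D) : G.Pre →⋆ₙₐ[ℂ] D where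
  __ : FreeStarAlgebra X →⋆ₙₐ[ℂ] D := FreeStarAlgebra.lift f

theorem uniformContinuous_liftPre (f : X → D) (hb : ∀ x, ‖f x‖ ≤ G.bound x)
    (hr : ∀ r ∈ G.rels, FreeStarAlgebra.lift f r = 0) :
    UniformContinuous (liftPre (G := G) f) := by
  refine (AddMonoidHomClass.lipschitz_of_bound (liftPre (G := G) f) 1 fun x => ?_).uniformContinuous
  rw [one_mul]
  exact G.le_univNorm (admissibleOf f hb hr) x

/-- The universal property (existence): a family in a C⋆-algebra that satisfies the bounds and the
relations of `G` extends to a ⋆-homomorphism on the universal C⋆-algebra. -/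
def lift (f : X → D) (hb : ∀ x, ‖f x‖ ≤ G.bound x)
    (hr : ∀ r ∈ G.rels, FreeStarAlgebra.lift f r = 0) : G.UniversalCStar →⋆ₙₐ[ℂ] D :=
  PreCStarAlgebra.extend (liftPre (G := G) f) (uniformContinuous_liftPre f hb hr)

theorem lift_toUniv_of (f : X → D) (hb : ∀ x, ‖f x‖ ≤ G.bound x)
    (hr : ∀ r ∈ G.rels, FreeStarAlgebra.lift f r = 0) (x : X) :
    lift f hb hr (G.toUniv (FreeStarAlgebra.of x)) = f x :=
  (PreCStarAlgebra.extend_coe (liftPre (G := G) f) (uniformContinuous_liftPre f hb hr)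
    (FreeStarAlgebra.of x)).trans (FreeStarAlgebra.lift_of f x)

/-- The universal property (uniqueness). -/
theorem hom_ext {φ ψ : G.UniversalCStar →⋆ₙₐ[ℂ] D}
    (h : ∀ x, φ (G.toUniv (FreeStarAlgebra.of x)) = ψ (G.toUniv (FreeStarAlgebra.of x))) :
    φ = ψ := by
  have hφ : Continuous φ := (AddMonoidHomClass.lipschitz_of_bound φ 1 fun a => by
    simpa using NonUnitalStarAlgHom.norm_apply_le φ a).continuous
  have hψ : Continuous ψ := (AddMonoidHomClass.lipschitz_of_bound ψ 1 fun a => by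
    simpa using NonUnitalStarAlgHom.norm_apply_le ψ a).continuous
  have key := G.denseRange_toUniv.equalizer hφ hψ (funext fun a =>
    FreeStarAlgebra.hom_ext (φ := φ.comp G.toUniv) (ψ := ψ.comp G.toUniv) h a)
  exact DFunLike.coe_injective key

end Lift

end CStarPresentation

/-! ## Full free products and maximal tensor products -/

section Products

variable {ι : Type v}

/-- The relations saying that, for each `i`, the generators indexed by `A i` form a copy of `A i`,
i.e. that `A i` is mapped by a ⋆-homomorphism. -/
inductive CopyRel (A : ι → Type w) [∀ i, NonUnitalCStarAlgebra (A i)] :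
    FreeStarAlgebra (Σ i, A i) → Prop
  | add (i : ι) (a b : A i) : CopyRel A (.of ⟨i, a + b⟩ - (.of ⟨i, a⟩ + .of ⟨i, b⟩))
  | smul (i : ι) (c : ℂ) (a : A i) : CopyRel A (.of ⟨i, c • a⟩ - c • .of ⟨i, a⟩)
  | mul (i : ι) (a b : A i) : CopyRel A (.of ⟨i, a * b⟩ - .of ⟨i, a⟩ * .of ⟨i, b⟩)
  | star (i : ι) (a : A i) : CopyRel A (.of ⟨i, star a⟩ - star (.of ⟨i, a⟩))

/-- The relations saying that the copies of the `A i` commute and have a common unit. -/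
inductive TensorRel (A : ι → Type w) [∀ i, CStarAlgebra (A i)] :
    FreeStarAlgebra (Σ i, A i) → Prop
  | comm (i j : ι) (hij : i ≠ j) (a : A i) (b : A j) :
      TensorRel A (.of ⟨i, a⟩ * .of ⟨j, b⟩ - .of ⟨j, b⟩ * .of ⟨i, a⟩)
  | one (i j : ι) : TensorRel A (.of ⟨i, 1⟩ - .of ⟨j, 1⟩)

/-- The norm bound is no restriction: ⋆-homomorphisms between C⋆-algebras are contractive. -/
def freeProductPresentation (A : ι → Type w) [∀ i, NonUnitalCStarAlgebra (A i)] :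
    CStarPresentation (Σ i, A i) where
  bound x := ‖x.2‖₊
  rels := {r | CopyRel A r}

/-- Generators and relations of the maximal tensor product. -/
def maxTensorPresentation (A : ι → Type w) [∀ i, CStarAlgebra (A i)] :
    CStarPresentation (Σ i, A i) where
  bound x := ‖x.2‖₊
  rels := {r | CopyRel A r ∨ TensorRel A r}

/-- The full (non-unital) free product: the universal C⋆-algebra generated by copies of the `A i`,
with no further relations. -/
abbrev FreeProduct (A : ι → Type w) [∀ i, NonUnitalCStarAlgebra (A i)] : Type (max v w) :=
  (freeProductPresentation A).UniversalCStar

/-- The maximal tensor product of a nonempty, possibly infinite, family of unital C⋆-algebras: the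
universal C⋆-algebra generated by commuting copies of the `A i` with a common unit. -/
abbrev MaxTensor (A : ι → Type w) [∀ i, CStarAlgebra (A i)] : Type (max v w) :=
  (maxTensorPresentation A).UniversalCStar

/-- A presentation containing the relations `CopyRel` comes with ⋆-homomorphisms from the `A i`. -/
def copyHom {A : ι → Type w} [∀ i, NonUnitalCStarAlgebra (A i)]
    (G : CStarPresentation (Σ i, A i)) (hG : ∀ r, CopyRel A r → r ∈ G.rels) (i : ι) :
    A i →⋆ₙₐ[ℂ] G.UniversalCStar :=
  have key (r) (hr : CopyRel A r) : G.toUniv r = 0 := G.toUniv_rel (hG r hr)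
  have hadd (a b : A i) : G.toUniv (.of ⟨i, a + b⟩) =
      G.toUniv (.of ⟨i, a⟩) + G.toUniv (.of ⟨i, b⟩) := by
    rw [← map_add, ← sub_eq_zero, ← map_sub]; exact key _ (.add i a b)
  have hsmul (c : ℂ) (a : A i) : G.toUniv (.of ⟨i, c • a⟩) = c • G.toUniv (.of ⟨i, a⟩) := by
    rw [← map_smul, ← sub_eq_zero, ← map_sub]; exact key _ (.smul i c a)
  { toFun := fun a => G.toUniv (.of ⟨i, a⟩)
    map_smul' := hsmul
    map_zero' := by simpa using hsmul 0 0
    map_add' := hadd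
    map_mul' := fun a b => by
      rw [← map_mul, ← sub_eq_zero, ← map_sub]; exact key _ (.mul i a b)
    map_star' := fun a => by
      rw [← map_star, ← sub_eq_zero, ← map_sub]; exact key _ (.star i a) }

theorem lift_copyRel {A : ι → Type w} [∀ i, NonUnitalCStarAlgebra (A i)] {D : Type*}
    [NonUnitalCStarAlgebra D] (φ : ∀ i, A i →⋆ₙₐ[ℂ] D) {r : FreeStarAlgebra (Σ i, A i)}
    (hr : CopyRel A r) : FreeStarAlgebra.lift (fun x : Σ i, A i => φ x.1 x.2) r = 0 := by
  cases hr <;> simp [map_star]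

namespace FreeProduct

variable {A : ι → Type w} [∀ i, NonUnitalCStarAlgebra (A i)]

/-- The canonical copy of `A i` in the full free product. -/
def incl (i : ι) : A i →⋆ₙₐ[ℂ] FreeProduct A :=
  copyHom (freeProductPresentation A) (fun _ hr => hr) i

/-- ⋆-homomorphisms `A i → D` induce a ⋆-homomorphism of the full free product. -/
def lift {D : Type*} [NonUnitalCStarAlgebra D] (φ : ∀ i, A i →⋆ₙₐ[ℂ] D) :
    FreeProduct A →⋆ₙₐ[ℂ] D :=
  CStarPresentation.lift (fun x => φ x.1 x.2)
    (fun x => NonUnitalStarAlgHom.norm_apply_le (φ x.1) x.2) (fun _ hr => lift_copyRel φ hr)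

@[simp]
theorem lift_incl {D : Type*} [NonUnitalCStarAlgebra D] (φ : ∀ i, A i →⋆ₙₐ[ℂ] D) (i : ι) (a : A i) :
    lift φ (incl i a) = φ i a :=
  CStarPresentation.lift_toUniv_of ..

theorem hom_ext {D : Type*} [NonUnitalCStarAlgebra D] {φ ψ : FreeProduct A →⋆ₙₐ[ℂ] D}
    (h : ∀ i a, φ (incl i a) = ψ (incl i a)) : φ = ψ :=
  CStarPresentation.hom_ext fun x => h x.1 x.2

end FreeProduct

namespace MaxTensor

variable {A : ι → Type w} [∀ i, CStarAlgebra (A i)]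

/-- The canonical copy of `A i` in the maximal tensor product. -/
def incl (i : ι) : A i →⋆ₙₐ[ℂ] MaxTensor A :=
  copyHom (maxTensorPresentation A) (fun _ hr => Or.inl hr) i

theorem incl_comm {i j : ι} (hij : i ≠ j) (a : A i) (b : A j) :
    incl i a * incl j b = incl j b * incl i a := by
  have h := (maxTensorPresentation A).toUniv_rel (Or.inr (.comm i j hij a b))
  rw [map_sub, map_mul, map_mul, sub_eq_zero] at h
  exact h

theorem incl_one (i j : ι) : incl (A := A) i 1 = incl j 1 := by
  have h := (maxTensorPresentation A).toUniv_rel (Or.inr (.one i j))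
  rw [map_sub, sub_eq_zero] at h
  exact h

/-- ⋆-homomorphisms `A i → D` with commuting ranges and a common image of the units induce a
⋆-homomorphism of the maximal tensor product. -/
def lift {D : Type*} [NonUnitalCStarAlgebra D] (φ : ∀ i, A i →⋆ₙₐ[ℂ] D)
    (hc : ∀ i j, i ≠ j → ∀ a b, φ i a * φ j b = φ j b * φ i a) (h1 : ∀ i j, φ i 1 = φ j 1) :
    MaxTensor A →⋆ₙₐ[ℂ] D :=
  CStarPresentation.lift (fun x => φ x.1 x.2)
    (fun x => NonUnitalStarAlgHom.norm_apply_le (φ x.1) x.2) (fun _ hr => by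
      rcases hr with hr | hr
      · exact lift_copyRel φ hr
      · cases hr with
        | comm i j hij a b => simp [hc i j hij a b]
        | one i j => simp [h1 i j])

@[simp]
theorem lift_incl {D : Type*} [NonUnitalCStarAlgebra D] (φ : ∀ i, A i →⋆ₙₐ[ℂ] D)
    (hc : ∀ i j, i ≠ j → ∀ a b, φ i a * φ j b = φ j b * φ i a) (h1 : ∀ i j, φ i 1 = φ j 1)
    (i : ι) (a : A i) : lift φ hc h1 (incl i a) = φ i a :=
  CStarPresentation.lift_toUniv_of ..

theorem hom_ext {D : Type*} [NonUnitalCStarAlgebra D] {φ ψ : MaxTensor A →⋆ₙₐ[ℂ] D}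
    (h : ∀ i a, φ (incl i a) = ψ (incl i a)) : φ = ψ :=
  CStarPresentation.hom_ext fun x => h x.1 x.2

end MaxTensor

/-- The canonical quotient map from the full free product to the maximal tensor product, which is
the identity on the copy of each `A i`. -/
def freeProductToTensor (A : ι → Type w) [∀ i, CStarAlgebra (A i)] :
    FreeProduct A →⋆ₙₐ[ℂ] MaxTensor A :=
  FreeProduct.lift MaxTensor.incl

end Products

/-- The family consisting of `A` and copies of `P` indexed by `κ`. -/
def withCopies (A P : Type u) (κ : Type v) : Option κ → Type u
  | none => A
  | some _ => P

instance instCStarAlgebraWithCopies (A P : Type u) (κ : Type v) [CStarAlgebra A] [CStarAlgebra P] :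
    ∀ i, CStarAlgebra (withCopies A P κ i)
  | none => inferInstanceAs (CStarAlgebra A)
  | some _ => inferInstanceAs (CStarAlgebra P)

/-! ## Semiprojectivity -/

/-- A closed two-sided ideal of a C⋆-algebra. (Stability under `star` is automatic for closed
ideals of C⋆-algebras.) -/
structure ClosedIdeal (D : Type u) [NonUnitalCStarAlgebra D] extends Submodule ℂ D where
  mul_mem_left' : ∀ a {x}, x ∈ carrier → a * x ∈ carrier
  mul_mem_right' : ∀ a {x}, x ∈ carrier → x * a ∈ carrier
  star_mem' : ∀ {x}, x ∈ carrier → star x ∈ carrier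
  isClosed' : IsClosed carrier

namespace ClosedIdeal

variable {D : Type u} [NonUnitalCStarAlgebra D] (J : ClosedIdeal D)

/-- The quotient ⋆-algebra `D / J`. As ⋆-homomorphisms between C⋆-algebras are defined
algebraically, no norm on the quotient is needed. -/
def Quotient : Type u := D ⧸ J.toSubmodule

instance : AddCommGroup J.Quotient := inferInstanceAs (AddCommGroup (D ⧸ J.toSubmodule))
instance : Module ℂ J.Quotient := inferInstanceAs (Module ℂ (D ⧸ J.toSubmodule))

/-- The quotient map. -/
def mkQ : D →ₗ[ℂ] J.Quotient := J.toSubmodule.mkQ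

theorem mkQ_surjective : Function.Surjective J.mkQ := J.toSubmodule.mkQ_surjective

theorem mkQ_eq_mkQ {x y : D} : J.mkQ x = J.mkQ y ↔ x - y ∈ J.toSubmodule :=
  Submodule.Quotient.eq J.toSubmodule

instance : Mul J.Quotient :=
  ⟨Quotient.map₂ (· * ·) fun x x' hx y y' hy => by
    replace hx := (Submodule.quotientRel_def _).1 hx
    replace hy := (Submodule.quotientRel_def _).1 hy
    refine (Submodule.quotientRel_def _).2 ?_
    have : x * y - x' * y' = (x - x') * y + x' * (y - y') := by
      rw [sub_mul, mul_sub]; abel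
    rw [this]
    exact J.add_mem (J.mul_mem_right' _ hx) (J.mul_mem_left' _ hy)⟩

instance : Star J.Quotient :=
  ⟨Quotient.map star fun x x' hx => by
    replace hx := (Submodule.quotientRel_def _).1 hx
    refine (Submodule.quotientRel_def _).2 ?_
    rw [← star_sub]
    exact J.star_mem' hx⟩

theorem mkQ_mul (x y : D) : J.mkQ (x * y) = J.mkQ x * J.mkQ y := rfl

theorem mkQ_star (x : D) : J.mkQ (star x) = star (J.mkQ x) := rfl

instance : NonUnitalRing J.Quotient where
  zero_mul x := by
    obtain ⟨x, rfl⟩ := J.mkQ_surjective x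
    rw [← map_zero J.mkQ, ← mkQ_mul, zero_mul]
  mul_zero x := by
    obtain ⟨x, rfl⟩ := J.mkQ_surjective x
    rw [← map_zero J.mkQ, ← mkQ_mul, mul_zero]
  left_distrib x y z := by
    obtain ⟨x, rfl⟩ := J.mkQ_surjective x
    obtain ⟨y, rfl⟩ := J.mkQ_surjective y
    obtain ⟨z, rfl⟩ := J.mkQ_surjective z
    simp only [← mkQ_mul, ← map_add, mul_add]
  right_distrib x y z := by
    obtain ⟨x, rfl⟩ := J.mkQ_surjective x
    obtain ⟨y, rfl⟩ := J.mkQ_surjective y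
    obtain ⟨z, rfl⟩ := J.mkQ_surjective z
    simp only [← mkQ_mul, ← map_add, add_mul]
  mul_assoc x y z := by
    obtain ⟨x, rfl⟩ := J.mkQ_surjective x
    obtain ⟨y, rfl⟩ := J.mkQ_surjective y
    obtain ⟨z, rfl⟩ := J.mkQ_surjective z
    simp only [← mkQ_mul, mul_assoc]

variable {J} in
/-- The canonical map `D / J → D / K` for closed ideals `J ⊆ K`. -/
def factor {K : ClosedIdeal D} (h : J.toSubmodule ≤ K.toSubmodule) : J.Quotient →ₗ[ℂ] K.Quotient :=
  Submodule.factor h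

theorem factor_mkQ {K : ClosedIdeal D} (h : J.toSubmodule ≤ K.toSubmodule) (x : D) :
    factor h (J.mkQ x) = K.mkQ x := rfl

end ClosedIdeal

/-- A separable C⋆-algebra `A` is semiprojective if, for every C⋆-algebra `D`, every increasing
sequence `J 0 ⊆ J 1 ⊆ ⋯` of closed ideals of `D` and `K` the closure of their union, every
⋆-homomorphism `A → D / K` lifts to a ⋆-homomorphism `A → D / J n` for some `n`. -/
def IsSemiprojective (A : Type u) [NonUnitalCStarAlgebra A] : Prop :=
  SeparableSpace A ∧
    ∀ (D : Type u) [NonUnitalCStarAlgebra D] (J : ℕ → ClosedIdeal D) (K : ClosedIdeal D)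
      (_ : Monotone fun n => (J n).toSubmodule)
      (_ : (K.carrier : Set D) = closure (⋃ n, (J n).carrier))
      (hJK : ∀ n, (J n).toSubmodule ≤ K.toSubmodule)
      (φ : A →⋆ₙₐ[ℂ] K.Quotient),
      ∃ (n : ℕ) (ψ : A →⋆ₙₐ[ℂ] (J n).Quotient), ∀ a, ClosedIdeal.factor (hJK n) (ψ a) = φ a

end

noncomputable section

/-! ## ⋆-homomorphisms between C⋆-algebras -/

namespace NonUnitalStarAlgHom

variable {D E : Type*} [NonUnitalCStarAlgebra D] [NonUnitalCStarAlgebra E] (φ : D →⋆ₙₐ[ℂ] E)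

/-! Fix an isomorphism `α` of A ⊗ P with A. On A ⊗ P^{⊗∞}, `MaxTensor.absorb` swallows the first
copy of P into A by means of `α` and shifts the remaining copies; it is an automorphism with inverse
`unabsorb`. A free product imposes no relations between its factors, so the same formulas on
generators define an endomorphism Φ = `FreeProduct.absorb` of Q, and π ∘ Φ = absorb ∘ π.

Unlike its counterpart, Φ has a large kernel. Once Φ^n has carried a copy of P into A, the image of
that copy commutes with Φ^n(A) and has the same unit. Every commutation or unit relation of the
tensor product therefore dies under some power of Φ (`exists_absorb_pow_eq_zero`). The ideals ker
Φ^n increase, they lie in ker π because absorb is injective, and their union is dense in ker π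
(`ker_freeProductToTensor_eq`). For the density, p ↦ inf ‖Φ^n p‖ is a C⋆-seminorm on ⋆-polynomials
that respects the tensor relations, so it is dominated by the norm of A ⊗ P^{⊗∞}
(`iInf_norm_le_univNorm`). Hence ‖Φ^n x‖ becomes arbitrarily small for x in ker π, and an element
with small image under Φ^n is close to ker Φ^n.

Now A ≅ A ⊗ P ≅ A ⊗ P^{⊗∞} ≅ Q / ker π, using P ≅ P^{⊗∞}. Semiprojectivity of A lifts this map to Q
/ ker Φ^n for some n, and Φ^n embeds that quotient in Q. The resulting map A → Q, followed by π, is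
the isomorphism `expand` followed by absorb^n. Precomposing with `contract` and unabsorb^n removes
both and gives the splitting. -/

theorem continuous_of_cstar : Continuous φ :=
  (AddMonoidHomClass.lipschitz_of_bound φ 1 fun a => by
    simpa using NonUnitalStarAlgHom.norm_apply_le φ a).continuous

/-- Truncating a self-adjoint element at the norm of its image does not change the image. -/
theorem exists_norm_le_of_isSelfAdjoint {x : D} (hx : IsSelfAdjoint x) :
    ∃ y, φ y = φ x ∧ ‖y‖ ≤ ‖φ x‖ := by
  have hφx : IsSelfAdjoint (φ x) := hx.map φ
  set c : ℝ := ‖φ x‖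
  have hc : 0 ≤ c := norm_nonneg _
  set g : ℝ → ℝ := fun t => max (-c) (min t c)
  have hg : Continuous g := by fun_prop
  have hg0 : g 0 = 0 := by simp [g, hc]
  -- Functional calculus commutes with φ, and `g` is the identity on the quasispectrum of `φ x`,
  -- which lies in [-c, c].
  refine ⟨cfcₙ g x, ?_, norm_cfcₙ_le fun t _ => ?_⟩
  · rw [NonUnitalStarAlgHomClass.map_cfcₙ φ g x hg.continuousOn hg0 φ.continuous_of_cstar hx hφx]
    conv_rhs => rw [← cfcₙ_id' ℝ (φ x) hφx]
    refine cfcₙ_congr fun t ht => ?_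
    have h := NonUnitalIsometricContinuousFunctionalCalculus.norm_quasispectrum_le (φ x) ht hφx
    obtain ⟨h1, h2⟩ := abs_le.1 h
    change max (-c) (min t c) = t
    rw [min_eq_left h2, max_eq_right h1]
  · exact abs_le.2 ⟨le_max_left _ _, max_le (by linarith) (min_le_right _ _)⟩

/-- Every element of the range of a ⋆-homomorphism has a preimage of controlled norm. -/
theorem exists_norm_le_two_mul (x : D) : ∃ y, φ y = φ x ∧ ‖y‖ ≤ 2 * ‖φ x‖ := by
  -- The real and imaginary parts are truncated separately, which costs the factor 2; any fixed
  -- constant would serve below.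
  obtain ⟨y, hy, hyn⟩ := φ.exists_norm_le_of_isSelfAdjoint (realPart x).2
  obtain ⟨z, hz, hzn⟩ := φ.exists_norm_le_of_isSelfAdjoint (imaginaryPart x).2
  have hre : ‖φ (realPart x : D)‖ ≤ ‖φ x‖ := by
    have : φ (realPart x : D) = (realPart (φ x) : E) := by
      simp only [realPart_apply_coe, map_add, map_star, ← Complex.coe_smul, map_smul]
    rw [this]
    exact realPart.norm_le (φ x)
  have him : ‖φ (imaginaryPart x : D)‖ ≤ ‖φ x‖ := by
    have : φ (imaginaryPart x : D) = (imaginaryPart (φ x) : E) := by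
      simp only [imaginaryPart_apply_coe, map_sub, map_star, ← Complex.coe_smul, map_smul]
    rw [this]
    exact imaginaryPart.norm_le (φ x)
  refine ⟨y + Complex.I • z, ?_, ?_⟩
  · rw [map_add, map_smul, hy, hz, ← map_smul, ← map_add, realPart_add_I_smul_imaginaryPart]
  · have := norm_add_le y (Complex.I • z)
    rw [norm_smul, Complex.norm_I, one_mul] at this
    linarith

/-- A ⋆-homomorphism of C⋆-algebras with dense range is surjective. -/
theorem surjective_of_denseRange (h : DenseRange φ) : Function.Surjective φ := by
  intro y
  let f : NormedAddGroupHom D E := AddMonoidHom.mkNormedAddGroupHom (φ : D →+ E) 1 fun a => by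
    simpa using NonUnitalStarAlgHom.norm_apply_le φ a
  have hf : f.SurjectiveOnWith f.range 2 := by
    rintro _ ⟨x, rfl⟩
    exact φ.exists_norm_le_two_mul x
  -- Successive approximation: since `D` is complete, preimages of controlled norm on the range
  -- yield preimages on its closure.
  have hf' := controlled_closure_of_complete two_pos one_pos hf
  obtain ⟨x, hx, -⟩ := hf' y (h y)
  exact ⟨x, hx⟩

end NonUnitalStarAlgHom

/-! ## Kernels -/

namespace ClosedIdeal

variable {D : Type u} {E : Type v} [NonUnitalCStarAlgebra D] [NonUnitalCStarAlgebra E]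

/-- The kernel of a ⋆-homomorphism. -/
def ker (φ : D →⋆ₙₐ[ℂ] E) : ClosedIdeal D where
  carrier := {x | φ x = 0}
  zero_mem' := map_zero φ
  add_mem' {x y} hx hy := by
    simp only [Set.mem_ofPred_eq] at hx hy ⊢
    rw [map_add, hx, hy, add_zero]
  smul_mem' c x hx := by
    simp only [Set.mem_ofPred_eq] at hx ⊢
    rw [map_smul, hx, smul_zero]
  mul_mem_left' a x hx := by
    simp only [Set.mem_ofPred_eq] at hx ⊢
    rw [map_mul, hx, mul_zero]
  mul_mem_right' a x hx := by
    simp only [Set.mem_ofPred_eq] at hx ⊢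
    rw [map_mul, hx, zero_mul]
  star_mem' {x} hx := by
    simp only [Set.mem_ofPred_eq] at hx ⊢
    rw [map_star, hx, star_zero]
  isClosed' := isClosed_eq φ.continuous_of_cstar continuous_const

theorem mem_ker {φ : D →⋆ₙₐ[ℂ] E} {x : D} : x ∈ (ker φ).toSubmodule ↔ φ x = 0 := Iff.rfl

theorem mkQ_ker_eq {φ : D →⋆ₙₐ[ℂ] E} {x y : D} :
    (ker φ).mkQ x = (ker φ).mkQ y ↔ φ x = φ y := by
  rw [mkQ_eq_mkQ, mem_ker, map_sub, sub_eq_zero]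

/-- The distance from x to ker φ_n is at most 2‖φ_n x‖: subtract from x a preimage of φ_n x of
controlled norm. -/
theorem mem_closure_iUnion_ker (φ : ℕ → D →⋆ₙₐ[ℂ] E) {x : D} (h : ∀ ε > 0, ∃ n, ‖φ n x‖ < ε) :
    x ∈ closure (⋃ n, (ker (φ n)).carrier) := by
  rw [Metric.mem_closure_iff]
  intro ε hε
  obtain ⟨n, hn⟩ := h (ε / 2) (by positivity)
  obtain ⟨y, hy, hyn⟩ := (φ n).exists_norm_le_two_mul x
  refine ⟨x - y, Set.mem_iUnion.2 ⟨n, ?_⟩, ?_⟩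
  · change φ n (x - y) = 0
    rw [map_sub, hy, sub_self]
  · rw [dist_eq_norm, sub_sub_cancel]
    linarith

/-- The ⋆-homomorphism `D / ker φ → E` induced by `φ`. -/
def kerLift (φ : D →⋆ₙₐ[ℂ] E) : (ker φ).Quotient →⋆ₙₐ[ℂ] E :=
  have mk (x : (ker φ).Quotient) : ∃ y, (ker φ).mkQ y = x := (ker φ).mkQ_surjective x
  let f : (ker φ).Quotient →ₗ[ℂ] E :=
    (ker φ).toSubmodule.liftQ ((φ : D →ₙₐ[ℂ] E) : D →ₗ[ℂ] E) fun _ hx => hx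
  have hf (x : D) : f ((ker φ).mkQ x) = φ x := rfl
  { toFun := f
    map_smul' := f.map_smul
    map_zero' := f.map_zero
    map_add' := f.map_add
    map_mul' := fun x y => by
      obtain ⟨x, rfl⟩ := mk x
      obtain ⟨y, rfl⟩ := mk y
      rw [← mkQ_mul, hf, hf, hf, map_mul]
    map_star' := fun x => by
      obtain ⟨x, rfl⟩ := mk x
      rw [← mkQ_star, hf, hf, map_star] }

@[simp]
theorem kerLift_mkQ (φ : D →⋆ₙₐ[ℂ] E) (x : D) : kerLift φ ((ker φ).mkQ x) = φ x := rfl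

/-- The inverse `E → D / ker φ` of the ⋆-homomorphism induced by a surjection `φ`. -/
def kerInv (φ : D →⋆ₙₐ[ℂ] E) (hφ : Function.Surjective φ) : E →⋆ₙₐ[ℂ] (ker φ).Quotient :=
  -- An arbitrary choice of preimages becomes a ⋆-homomorphism modulo the kernel, because equality
  -- there is tested by applying φ.
  have hs := Function.surjInv_eq hφ
  { toFun := fun y => (ker φ).mkQ (Function.surjInv hφ y)
    map_smul' := fun c y => by
      rw [MonoidHom.id_apply, ← map_smul, mkQ_ker_eq, map_smul, hs, hs]
    map_zero' := by rw [← map_zero (ker φ).mkQ, mkQ_ker_eq, hs, map_zero]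
    map_add' := fun x y => by rw [← map_add, mkQ_ker_eq, map_add, hs, hs, hs]
    map_mul' := fun x y => by rw [← mkQ_mul, mkQ_ker_eq, map_mul, hs, hs, hs]
    map_star' := fun x => by rw [← mkQ_star, mkQ_ker_eq, map_star, hs, hs] }

theorem kerInv_apply (φ : D →⋆ₙₐ[ℂ] E) (hφ : Function.Surjective φ) (x : D) :
    kerInv φ hφ (φ x) = (ker φ).mkQ x :=
  mkQ_ker_eq.2 (Function.surjInv_eq hφ _)

end ClosedIdeal

/-! ## Universal C⋆-algebras -/

namespace CStarPresentation

variable {X : Type u} (G : CStarPresentation X)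

variable {G} in
/-- Induction on the generators of a universal C⋆-algebra. -/
theorem induction_on {motive : G.UniversalCStar → Prop} (y : G.UniversalCStar)
    (closed : IsClosed {y | motive y})
    (add : ∀ x y, motive x → motive y → motive (x + y))
    (smul : ∀ (c : ℂ) x, motive x → motive (c • x))
    (mul : ∀ x y, motive x → motive y → motive (x * y)) (zero : motive 0)
    (of : ∀ x, motive (G.toUniv (.of x)))
    (star_of : ∀ x, motive (star (G.toUniv (.of x)))) : motive y := by
  refine G.denseRange_toUniv.induction_on y closed fun p => ?_
  induction p using FreeStarAlgebra.induction_linear with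
  | zero => simpa using zero
  | add x y hx hy => rw [map_add]; exact add _ _ hx hy
  | monomial w c =>
    rw [← mul_one c, ← FreeStarAlgebra.smul_monomial, map_smul]
    refine smul _ _ ?_
    induction w using FreeSemigroup.recOnMul with
    | ih1 s =>
      rcases s with x | x
      · exact of x
      · have : FreeStarAlgebra.monomial (FreeSemigroup.of (Sum.inr x)) 1 =
            star (FreeStarAlgebra.of x) := by
          simp [FreeStarAlgebra.of, FreeStarAlgebra.star_monomial, FreeStar.wordStar_of]
        rw [this, map_star]
        exact star_of x
    | ih2 s b h1 h2 =>
      rw [← mul_one (1 : ℂ), ← FreeStarAlgebra.monomial_mul, map_mul]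
      exact mul _ _ h1 h2

open Filter Topology in
/-- If the representations `f n` satisfy the bounds of `G` and, asymptotically, its relations, then
their limiting norm is at most the universal norm. -/
theorem iInf_norm_le_univNorm {D : Type*} [NonUnitalCStarAlgebra D]
    (f : ℕ → FreeStarAlgebra X →⋆ₙₐ[ℂ] D) (hf : ∀ x, Antitone fun n => ‖f n x‖)
    (hb : ∀ x, ‖f 0 (.of x)‖ ≤ G.bound x) (hr : ∀ r ∈ G.rels, ∃ n, f n r = 0)
    (x : FreeStarAlgebra X) : ⨅ n, ‖f n x‖ ≤ G.univNorm x := by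
  have hbdd (x : FreeStarAlgebra X) : BddBelow (Set.range fun n => ‖f n x‖) :=
    ⟨0, by rintro _ ⟨n, rfl⟩; exact norm_nonneg _⟩
  -- Monotonicity turns the infimum into a limit. This is what lets subadditivity and the
  -- C⋆-identity survive; an infimum of seminorms need not be a seminorm.
  have ht (x : FreeStarAlgebra X) : Tendsto (fun n => ‖f n x‖) atTop (𝓝 (⨅ n, ‖f n x‖)) :=
    tendsto_atTop_ciInf (hf x) (hbdd x)
  let p : G.Admissible :=
    ⟨{ toFun := fun x => ⨅ n, ‖f n x‖
       map_zero' := by simp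
       add_le' := fun x y => le_of_tendsto_of_tendsto' (ht _) ((ht x).add (ht y)) fun n => by
        rw [map_add]; exact norm_add_le _ _
       neg' := fun x => by simp
       smul' := fun c x => tendsto_nhds_unique (ht _)
        (((ht x).const_mul ‖c‖).congr fun n => by rw [map_smul, norm_smul])
       mul_le' := fun x y => le_of_tendsto_of_tendsto' (ht _) ((ht x).mul (ht y)) fun n => by
        rw [map_mul]; exact norm_mul_le _ _
       star_mul_self' := fun x => tendsto_nhds_unique (ht _)
        (((ht x).pow 2).congr fun n => by
          rw [map_mul, map_star, CStarRing.norm_star_mul_self, sq]) },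
     fun x => (ciInf_le (hbdd _) 0).trans (hb x),
     fun r h => by
      -- Vanishing at a single index forces the infimum to vanish.
      obtain ⟨n, hn⟩ := hr r h
      refine le_antisymm ((ciInf_le (hbdd r) n).trans ?_) (Real.iInf_nonneg fun n => norm_nonneg _)
      rw [hn, norm_zero]⟩
  exact G.le_univNorm p x

end CStarPresentation

/-! ### Unit and commutants in maximal tensor products -/

namespace MaxTensor

variable {ι : Type v} {A : ι → Type w} [∀ i, CStarAlgebra (A i)]

theorem induction_on {motive : MaxTensor A → Prop} (y : MaxTensor A)
    (closed : IsClosed {y | motive y})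
    (add : ∀ x y, motive x → motive y → motive (x + y))
    (smul : ∀ (c : ℂ) x, motive x → motive (c • x))
    (mul : ∀ x y, motive x → motive y → motive (x * y)) (zero : motive 0)
    (incl : ∀ i a, motive (incl i a)) : motive y := by
  refine CStarPresentation.induction_on y closed add smul mul zero (fun x => incl x.1 x.2)
    fun x => ?_
  have := incl x.1 (star x.2)
  rwa [map_star] at this

/-- The universal algebra is built without a unit; the common unit of the copies is shown here to
act as one, by checking it on generators. -/
theorem incl_one_mul (i : ι) (y : MaxTensor A) : incl i 1 * y = y := by
  refine induction_on (motive := fun y => incl i 1 * y = y) y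
    (isClosed_eq (by fun_prop) (by fun_prop)) (fun x y hx hy => ?_)
    (fun c x hx => ?_) (fun x y hx hy => ?_) (mul_zero _) fun j a => ?_
  · rw [mul_add, hx, hy]
  · rw [mul_smul_comm, hx]
  · rw [← mul_assoc, hx]
  · rw [incl_one i j, ← map_mul, one_mul]

/-- A family of elements commuting with the generators commutes with the whole algebra. -/
theorem commute_map {D : Type*} [NonUnitalCStarAlgebra D] (φ : MaxTensor A →⋆ₙₐ[ℂ] D) (d : D)
    (h : ∀ i a, φ (incl i a) * d = d * φ (incl i a)) (y : MaxTensor A) : φ y * d = d * φ y := by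
  have hφ := φ.continuous_of_cstar
  refine induction_on (motive := fun y => φ y * d = d * φ y) y
    (isClosed_eq (by fun_prop) (by fun_prop)) (fun x y hx hy => ?_)
    (fun c x hx => ?_) (fun x y hx hy => ?_) (by simp) h
  · rw [map_add, add_mul, mul_add, hx, hy]
  · rw [map_smul, smul_mul_assoc, mul_smul_comm, hx]
  · rw [map_mul, mul_assoc, hy, ← mul_assoc, hx, mul_assoc]

/-- Isomorphisms are only assumed non-unital, but surjectivity makes the image of a left unit a left
unit of `B`, hence equal to 1. -/
theorem map_incl_one {B : Type*} [CStarAlgebra B] (α : MaxTensor A ≃⋆ₐ[ℂ] B) (i : ι) :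
    α (incl i 1) = 1 := by
  obtain ⟨y, hy⟩ : ∃ y, α y = 1 := α.surjective 1
  rw [← mul_one (α _), ← hy, ← map_mul, incl_one_mul]

end MaxTensor

/-! ### The canonical map from the free product to the tensor product -/

theorem freeProductToTensor_incl {ι : Type v} (A : ι → Type w) [∀ i, CStarAlgebra (A i)] (i : ι)
    (a : A i) : freeProductToTensor A (FreeProduct.incl i a) = MaxTensor.incl i a :=
  FreeProduct.lift_incl ..

theorem freeProductToTensor_toUniv {ι : Type v} (A : ι → Type w) [∀ i, CStarAlgebra (A i)]
    (p : FreeStarAlgebra (Σ i, A i)) :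
    freeProductToTensor A ((freeProductPresentation A).toUniv p) =
      (maxTensorPresentation A).toUniv p :=
  FreeStarAlgebra.hom_ext
    (φ := (freeProductToTensor A).comp (freeProductPresentation A).toUniv)
    (ψ := (maxTensorPresentation A).toUniv) (fun x => freeProductToTensor_incl A x.1 x.2) p

theorem freeProductToTensor_surjective {ι : Type v} (A : ι → Type w) [∀ i, CStarAlgebra (A i)] :
    Function.Surjective (freeProductToTensor A) := by
  refine NonUnitalStarAlgHom.surjective_of_denseRange _
    ((maxTensorPresentation A).denseRange_toUniv.mono ?_)
  rintro _ ⟨p, rfl⟩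
  exact ⟨_, freeProductToTensor_toUniv A p⟩

/-- If the kernels of the powers of a ⋆-endomorphism of the free product exhaust the relations of
the tensor product, they are jointly dense in the kernel of the canonical map. -/
theorem mem_closure_iUnion_ker {ι : Type v} (A : ι → Type w) [∀ i, CStarAlgebra (A i)]
    (Φ : FreeProduct A →⋆ₙₐ[ℂ] FreeProduct A)
    (hΦ : ∀ r, TensorRel A r → ∃ n, (Φ ^ n) ((freeProductPresentation A).toUniv r) = 0)
    {x : FreeProduct A} (hx : freeProductToTensor A x = 0) :
    x ∈ closure (⋃ n, (ClosedIdeal.ker (Φ ^ n)).carrier) := by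
  refine ClosedIdeal.mem_closure_iUnion_ker (fun n => Φ ^ n) fun ε hε => ?_
  -- Approximate x by a ⋆-polynomial p within ε/4. As π x = 0, the tensor norm of p is at most ε/4,
  -- so some ‖Φ^n p‖ is below ε/2, and ‖Φ^n x‖ < ε/4 + ε/2.
  obtain ⟨p, hp⟩ := Metric.denseRange_iff.1 (freeProductPresentation A).denseRange_toUniv x
    (ε / 4) (by positivity)
  rw [dist_eq_norm] at hp
  have hpT : (maxTensorPresentation A).univNorm p ≤ ε / 4 := by
    rw [← CStarPresentation.norm_toUniv, ← freeProductToTensor_toUniv]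
    have := NonUnitalStarAlgHom.norm_apply_le (freeProductToTensor A)
      (x - (freeProductPresentation A).toUniv p)
    rw [map_sub, hx, zero_sub, norm_neg] at this
    exact this.trans hp.le
  -- Both presentations have the same bounds and copy relations, so these hold already at n = 0;
  -- only the tensor relations require higher powers. The norms decrease because Φ is contractive.
  have hinf := (maxTensorPresentation A).iInf_norm_le_univNorm
    (fun n => (Φ ^ n).comp (freeProductPresentation A).toUniv)
    (fun q => antitone_nat_of_succ_le fun n => by
      rw [pow_succ']
      exact NonUnitalStarAlgHom.norm_apply_le Φ _)
    (fun x => by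
      rw [pow_zero]
      exact ((freeProductPresentation A).norm_toUniv _).trans_le (ciSup_le fun p => p.2.1 x))
    (fun r hr => by
      rcases hr with hr | hr
      · refine ⟨0, ?_⟩
        rw [pow_zero]
        exact (freeProductPresentation A).toUniv_rel hr
      · exact hΦ r hr) p
  obtain ⟨n, hn⟩ := exists_lt_of_ciInf_lt
    (lt_of_le_of_lt (hinf.trans hpT) (by linarith : ε / 4 < ε / 2))
  refine ⟨n, ?_⟩
  have h1 := NonUnitalStarAlgHom.norm_apply_le (Φ ^ n) (x - (freeProductPresentation A).toUniv p)
  have h2 := norm_add_le ((Φ ^ n) (x - (freeProductPresentation A).toUniv p))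
    ((Φ ^ n) ((freeProductPresentation A).toUniv p))
  rw [← map_add, sub_add_cancel] at h2
  have hn' : ‖(Φ ^ n) ((freeProductPresentation A).toUniv p)‖ < ε / 2 := hn
  linarith

/-! ## Tensor products of `A` with copies of `P` -/

section WithCopies

variable {A P : Type u} {κ : Type v} [CStarAlgebra A] [CStarAlgebra P]

/-- A family of ⋆-homomorphisms on `A` and on the copies of `P`. -/
def withCopiesFamily {D : Type*} [NonUnitalCStarAlgebra D] (f : A →⋆ₙₐ[ℂ] D)
    (g : κ → P →⋆ₙₐ[ℂ] D) : ∀ i, withCopies A P κ i →⋆ₙₐ[ℂ] D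
  | none => f
  | some k => g k

/-- The sequence `g₀, g 0, g 1, …`. -/
def consHom {D : Type*} [NonUnitalCStarAlgebra D] (g₀ : P →⋆ₙₐ[ℂ] D) (g : ℕ → P →⋆ₙₐ[ℂ] D) :
    ℕ → P →⋆ₙₐ[ℂ] D
  | 0 => g₀
  | k + 1 => g k

namespace MaxTensor

/-- The copy of `A`. -/
def inclLeft (A P : Type u) (κ : Type v) [CStarAlgebra A] [CStarAlgebra P] :
    A →⋆ₙₐ[ℂ] MaxTensor (withCopies A P κ) :=
  incl (A := withCopies A P κ) none

/-- The `k`-th copy of `P`. -/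
def inclRight (A P : Type u) {κ : Type v} [CStarAlgebra A] [CStarAlgebra P] (k : κ) :
    P →⋆ₙₐ[ℂ] MaxTensor (withCopies A P κ) :=
  incl (A := withCopies A P κ) (some k)

theorem inclLeft_comm (k : κ) (a : A) (b : P) :
    inclLeft A P κ a * inclRight A P k b = inclRight A P k b * inclLeft A P κ a :=
  incl_comm (A := withCopies A P κ) (i := none) (j := some k) (by simp) a b

theorem inclRight_comm {k l : κ} (h : k ≠ l) (a b : P) :
    inclRight A P k a * inclRight A P l b = inclRight A P l b * inclRight A P k a :=
  incl_comm (A := withCopies A P κ) (i := some k) (j := some l) (by simpa using h) a b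

theorem inclLeft_one (k : κ) : inclLeft A P κ 1 = inclRight A P k 1 :=
  incl_one (A := withCopies A P κ) none (some k)

section Lift

variable {D : Type*} [NonUnitalCStarAlgebra D]

/-- ⋆-homomorphisms on `A` and on the copies of `P` with commuting ranges and a common image of the
units induce a ⋆-homomorphism of the tensor product. -/
def liftCopies (f : A →⋆ₙₐ[ℂ] D) (g : κ → P →⋆ₙₐ[ℂ] D)
    (hfg : ∀ k a b, f a * g k b = g k b * f a)
    (hgg : ∀ k l, k ≠ l → ∀ a b, g k a * g l b = g l b * g k a) (h1 : ∀ k, f 1 = g k 1) :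
    MaxTensor (withCopies A P κ) →⋆ₙₐ[ℂ] D :=
  lift (withCopiesFamily f g)
    (fun i j hij a b => by
      rcases i with _ | k <;> rcases j with _ | l
      · exact (hij rfl).elim
      · exact hfg l a b
      · exact (hfg k b a).symm
      · exact hgg k l (fun h => hij (congrArg some h)) a b)
    (fun i j => by
      rcases i with _ | k <;> rcases j with _ | l
      · rfl
      · exact h1 l
      · exact (h1 k).symm
      · exact (h1 k).symm.trans (h1 l))

variable {f : A →⋆ₙₐ[ℂ] D} {g : κ → P →⋆ₙₐ[ℂ] D} {hfg : ∀ k a b, f a * g k b = g k b * f a}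
  {hgg : ∀ k l, k ≠ l → ∀ a b, g k a * g l b = g l b * g k a} {h1 : ∀ k, f 1 = g k 1}

@[simp]
theorem liftCopies_inclLeft (a : A) : liftCopies f g hfg hgg h1 (inclLeft A P κ a) = f a :=
  lift_incl (A := withCopies A P κ) (withCopiesFamily f g) _ _ none a

@[simp]
theorem liftCopies_inclRight (k : κ) (a : P) :
    liftCopies f g hfg hgg h1 (inclRight A P k a) = g k a :=
  lift_incl (A := withCopies A P κ) (withCopiesFamily f g) _ _ (some k) a

theorem copies_hom_ext {φ ψ : MaxTensor (withCopies A P κ) →⋆ₙₐ[ℂ] D}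
    (hl : ∀ a, φ (inclLeft A P κ a) = ψ (inclLeft A P κ a))
    (hr : ∀ k a, φ (inclRight A P k a) = ψ (inclRight A P k a)) : φ = ψ :=
  hom_ext fun i => match i with
    | none => hl
    | some k => hr k

end Lift

theorem map_inclLeft_one {B : Type*} [CStarAlgebra B] (α : MaxTensor (withCopies A P κ) ≃⋆ₐ[ℂ] B) :
    α (inclLeft A P κ 1) = 1 :=
  map_incl_one α none

theorem map_inclRight_one {B : Type*} [CStarAlgebra B] (α : MaxTensor (withCopies A P κ) ≃⋆ₐ[ℂ] B)
    (k : κ) : α (inclRight A P k 1) = 1 :=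
  map_incl_one α (some k)

theorem commute_map_copies {D : Type*} [NonUnitalCStarAlgebra D]
    (φ : MaxTensor (withCopies A P κ) →⋆ₙₐ[ℂ] D) (d : D)
    (hl : ∀ a, φ (inclLeft A P κ a) * d = d * φ (inclLeft A P κ a))
    (hr : ∀ k a, φ (inclRight A P k a) * d = d * φ (inclRight A P k a))
    (y : MaxTensor (withCopies A P κ)) : φ y * d = d * φ y :=
  commute_map φ d (fun i => match i with
    | none => hl
    | some k => hr k) y

/-! ### Absorbing one copy of `P` into `A` -/

section Absorb

variable (α : MaxTensor (withCopies A P Unit) ≃⋆ₐ[ℂ] A)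

/-- An isomorphism `A ⊗ P ≅ A`, restricted to `A`. -/
def absorbLeft : A →⋆ₙₐ[ℂ] A :=
  (α : MaxTensor (withCopies A P Unit) →⋆ₙₐ[ℂ] A).comp (inclLeft A P Unit)

/-- An isomorphism `A ⊗ P ≅ A`, restricted to `P`. -/
def absorbRight : P →⋆ₙₐ[ℂ] A :=
  (α : MaxTensor (withCopies A P Unit) →⋆ₙₐ[ℂ] A).comp (inclRight A P ())

theorem absorbLeft_apply (a : A) : absorbLeft α a = α (inclLeft A P Unit a) := rfl

theorem absorbRight_apply (a : P) : absorbRight α a = α (inclRight A P () a) := rfl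

theorem absorb_comm (a : A) (b : P) :
    absorbLeft α a * absorbRight α b = absorbRight α b * absorbLeft α a := by
  rw [absorbLeft_apply, absorbRight_apply, ← map_mul, inclLeft_comm, map_mul]

theorem absorbLeft_one : absorbLeft α 1 = 1 := map_inclLeft_one α

theorem absorbRight_one : absorbRight α 1 = 1 := map_inclRight_one α ()

/-- The endomorphism of `A ⊗ P^{⊗∞}` absorbing the first copy of `P` into `A` by means of
`A ⊗ P ≅ A` and shifting the other copies. -/
def absorb : MaxTensor (withCopies A P ℕ) →⋆ₙₐ[ℂ] MaxTensor (withCopies A P ℕ) :=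
  liftCopies ((inclLeft A P ℕ).comp (absorbLeft α))
    (consHom ((inclLeft A P ℕ).comp (absorbRight α)) fun k => inclRight A P k)
    (fun k a b => by
      rcases k with _ | k
      · change inclLeft A P ℕ (absorbLeft α a) * inclLeft A P ℕ (absorbRight α b) =
          inclLeft A P ℕ (absorbRight α b) * inclLeft A P ℕ (absorbLeft α a)
        rw [← map_mul, absorb_comm, map_mul]
      · exact inclLeft_comm k _ b)
    (fun k l hkl a b => by
      rcases k with _ | k <;> rcases l with _ | l
      · exact (hkl rfl).elim
      · exact inclLeft_comm l _ b
      · exact (inclLeft_comm k _ a).symm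
      · exact inclRight_comm (fun h => hkl (congrArg _ h)) a b)
    (fun k => by
      rcases k with _ | k
      · exact congrArg (inclLeft A P ℕ) ((absorbLeft_one α).trans (absorbRight_one α).symm)
      · exact (congrArg (inclLeft A P ℕ) (absorbLeft_one α)).trans (inclLeft_one k))

theorem absorb_inclLeft (a : A) :
    absorb α (inclLeft A P ℕ a) = inclLeft A P ℕ (absorbLeft α a) :=
  liftCopies_inclLeft a

theorem absorb_inclRight_zero (a : P) :
    absorb α (inclRight A P 0 a) = inclLeft A P ℕ (absorbRight α a) :=
  liftCopies_inclRight 0 a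

theorem absorb_inclRight_succ (k : ℕ) (a : P) :
    absorb α (inclRight A P (k + 1) a) = inclRight A P k a :=
  liftCopies_inclRight (k + 1) a

/-- The inclusion of `A ⊗ P` in `A ⊗ P^{⊗∞}` by means of the first copy of `P`. -/
def inclFirst (A P : Type u) [CStarAlgebra A] [CStarAlgebra P] :
    MaxTensor (withCopies A P Unit) →⋆ₙₐ[ℂ] MaxTensor (withCopies A P ℕ) :=
  liftCopies (inclLeft A P ℕ) (fun _ => inclRight A P 0) (fun _ => inclLeft_comm 0)
    (fun _ _ h => (h rfl).elim) fun _ => inclLeft_one 0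

/-- The inverse of `absorb`. -/
def unabsorb : MaxTensor (withCopies A P ℕ) →⋆ₙₐ[ℂ] MaxTensor (withCopies A P ℕ) :=
  liftCopies ((inclFirst A P).comp (α.symm : A →⋆ₙₐ[ℂ] MaxTensor (withCopies A P Unit)))
    (fun k => inclRight A P (k + 1))
    (fun k a b => by
      -- `α.symm a` is a general element of A ⊗ P, so commutation with the shifted copies has to be
      -- reduced to generators.
      refine commute_map_copies (inclFirst A P) _ (fun c => ?_) (fun _ c => ?_) (α.symm a)
      · rw [inclFirst, liftCopies_inclLeft, inclLeft_comm]
      · rw [inclFirst, liftCopies_inclRight, inclRight_comm (Nat.succ_ne_zero k).symm])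
    (fun k l hkl => inclRight_comm (by simpa using hkl))
    (fun k => by
      change inclFirst A P (α.symm 1) = _
      rw [← map_inclLeft_one α, StarAlgEquiv.symm_apply_apply, inclFirst, liftCopies_inclLeft,
        inclLeft_one])

theorem unabsorb_inclLeft (a : A) : unabsorb α (inclLeft A P ℕ a) = inclFirst A P (α.symm a) :=
  liftCopies_inclLeft a

theorem unabsorb_inclRight (k : ℕ) (a : P) :
    unabsorb α (inclRight A P k a) = inclRight A P (k + 1) a :=
  liftCopies_inclRight k a

theorem absorb_mul_unabsorb : absorb α * unabsorb α = 1 := by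
  -- On A the inverse passes through `α.symm a`, which is not a generator. This identity of maps on
  -- A ⊗ P evaluates `absorb` there.
  have h : (absorb α).comp (inclFirst A P) =
      (inclLeft A P ℕ).comp (α : MaxTensor (withCopies A P Unit) →⋆ₙₐ[ℂ] A) :=
    copies_hom_ext
      (fun a => by
        change absorb α (inclFirst A P _) = inclLeft A P ℕ (absorbLeft α a)
        rw [inclFirst, liftCopies_inclLeft, absorb_inclLeft])
      (fun k a => by
        change absorb α (inclFirst A P _) = inclLeft A P ℕ (absorbRight α a)
        rw [inclFirst, liftCopies_inclRight, absorb_inclRight_zero])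
  refine copies_hom_ext (fun a => ?_) (fun k a => ?_)
  · change absorb α (unabsorb α _) = inclLeft A P ℕ a
    rw [unabsorb_inclLeft]
    refine (DFunLike.congr_fun h (α.symm a)).trans ?_
    exact congrArg (inclLeft A P ℕ) (α.apply_symm_apply a)
  · change absorb α (unabsorb α _) = inclRight A P k a
    rw [unabsorb_inclRight, absorb_inclRight_succ]

theorem unabsorb_mul_absorb : unabsorb α * absorb α = 1 := by
  refine copies_hom_ext (fun a => ?_) (fun k a => ?_)
  · change unabsorb α (absorb α _) = inclLeft A P ℕ a
    rw [absorb_inclLeft, unabsorb_inclLeft, absorbLeft_apply, StarAlgEquiv.symm_apply_apply,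
      inclFirst, liftCopies_inclLeft]
  · change unabsorb α (absorb α _) = inclRight A P k a
    rcases k with _ | k
    · rw [absorb_inclRight_zero, unabsorb_inclLeft, absorbRight_apply,
        StarAlgEquiv.symm_apply_apply, inclFirst, liftCopies_inclRight]
    · rw [absorb_inclRight_succ, unabsorb_inclRight]

theorem absorb_pow_mul_unabsorb_pow (n : ℕ) : absorb α ^ n * unabsorb α ^ n = 1 :=
  pow_mul_pow_eq_one n (absorb_mul_unabsorb α)

/-- This places ker Φ^n inside ker π. -/
theorem absorb_pow_injective (n : ℕ) : Function.Injective (absorb α ^ n) := by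
  have h := pow_mul_pow_eq_one n (unabsorb_mul_absorb α)
  intro x y hxy
  have hxy' := congrArg (unabsorb α ^ n) hxy
  exact ((DFunLike.congr_fun h x).symm.trans hxy').trans (DFunLike.congr_fun h y)

end Absorb

/-! ### `A ⊗ P^{⊗∞} ≅ A` -/

section Infinite

variable (α : MaxTensor (withCopies A P Unit) ≃⋆ₐ[ℂ] A) (τ : P ≃⋆ₐ[ℂ] MaxTensor (fun _ : ℕ => P))

/-- The inclusion of `P^{⊗∞}` in `A ⊗ P^{⊗∞}`. -/
def inclTail (A P : Type u) [CStarAlgebra A] [CStarAlgebra P] :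
    MaxTensor (fun _ : ℕ => P) →⋆ₙₐ[ℂ] MaxTensor (withCopies A P ℕ) :=
  lift (fun k => inclRight A P k) (fun _ _ => inclRight_comm)
    fun k l => (inclLeft_one k).symm.trans (inclLeft_one l)

theorem inclTail_incl (k : ℕ) (a : P) :
    inclTail A P (incl (A := fun _ : ℕ => P) k a) = inclRight A P k a :=
  lift_incl ..

/-- The map `A ⊗ P → A ⊗ P^{⊗∞}` induced by `P ≅ P^{⊗∞}`. -/
def expandRight : MaxTensor (withCopies A P Unit) →⋆ₙₐ[ℂ] MaxTensor (withCopies A P ℕ) :=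
  liftCopies (inclLeft A P ℕ)
    (fun _ => (inclTail A P).comp (τ : P →⋆ₙₐ[ℂ] MaxTensor (fun _ : ℕ => P)))
    (fun _ a b => (commute_map (inclTail A P) _
      (fun i c => by rw [inclTail_incl, inclLeft_comm]) (τ b)).symm)
    (fun _ _ h => (h rfl).elim)
    (fun _ => by
      change _ = inclTail A P (τ 1)
      rw [← map_incl_one τ.symm 0, StarAlgEquiv.apply_symm_apply, inclTail_incl, inclLeft_one 0])

theorem expandRight_inclLeft (a : A) : expandRight τ (inclLeft A P Unit a) = inclLeft A P ℕ a :=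
  liftCopies_inclLeft a

theorem expandRight_inclRight (a : P) :
    expandRight (A := A) τ (inclRight A P () a) = inclTail A P (τ a) :=
  liftCopies_inclRight () a

/-- The isomorphism `A ≅ A ⊗ P ≅ A ⊗ P^{⊗∞}`. -/
def expand : A →⋆ₙₐ[ℂ] MaxTensor (withCopies A P ℕ) :=
  (expandRight τ).comp (α.symm : A →⋆ₙₐ[ℂ] MaxTensor (withCopies A P Unit))

/-- The isomorphism `A ⊗ P^{⊗∞} ≅ A ⊗ P ≅ A`. -/
def contract : MaxTensor (withCopies A P ℕ) →⋆ₙₐ[ℂ] A :=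
  liftCopies (absorbLeft α)
    (fun k => ((absorbRight α).comp (τ.symm : MaxTensor (fun _ : ℕ => P) →⋆ₙₐ[ℂ] P)).comp
      (incl (A := fun _ : ℕ => P) k))
    (fun k a b => absorb_comm α _ _)
    (fun k l hkl a b => by
      have h := congrArg (fun y => absorbRight α (τ.symm y))
        (incl_comm (A := fun _ : ℕ => P) hkl a b)
      simp only [map_mul] at h
      exact h)
    (fun k => by
      have h := congrArg (absorbRight α) (map_incl_one τ.symm k)
      rw [absorbRight_one] at h
      exact (absorbLeft_one α).trans h.symm)

theorem contract_inclLeft (a : A) : contract α τ (inclLeft A P ℕ a) = α (inclLeft A P Unit a) :=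
  liftCopies_inclLeft a

theorem contract_inclRight (k : ℕ) (a : P) :
    contract α τ (inclRight A P k a) =
      α (inclRight A P () (τ.symm (incl (A := fun _ : ℕ => P) k a))) :=
  liftCopies_inclRight k a

/-- Of the two composites, this is the one that cancels in the splitting. -/
theorem expand_contract (y : MaxTensor (withCopies A P ℕ)) :
    expand α τ (contract α τ y) = y := by
  have h : (expand α τ).comp (contract α τ) =
      NonUnitalStarAlgHom.id ℂ (MaxTensor (withCopies A P ℕ)) := by
    refine copies_hom_ext (fun a => ?_) (fun k a => ?_)
    · change expandRight τ (α.symm (contract α τ _)) = inclLeft A P ℕ a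
      rw [contract_inclLeft, StarAlgEquiv.symm_apply_apply, expandRight_inclLeft]
    · change expandRight τ (α.symm (contract α τ _)) = inclRight A P k a
      rw [contract_inclRight, StarAlgEquiv.symm_apply_apply, expandRight_inclRight,
        StarAlgEquiv.apply_symm_apply, inclTail_incl]
  exact DFunLike.congr_fun h y

end Infinite

end MaxTensor

/-! ### Absorbing copies of `P` in the free product -/

namespace FreeProduct

open MaxTensor

variable (α : MaxTensor (withCopies A P Unit) ≃⋆ₐ[ℂ] A)

/-- The endomorphism of the free product lifting `MaxTensor.absorb`. -/
def absorb : FreeProduct (withCopies A P ℕ) →⋆ₙₐ[ℂ] FreeProduct (withCopies A P ℕ) :=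
  lift (withCopiesFamily ((incl (A := withCopies A P ℕ) none).comp (absorbLeft α))
    (consHom ((incl (A := withCopies A P ℕ) none).comp (absorbRight α))
      fun k => incl (A := withCopies A P ℕ) (some k)))

theorem absorb_incl_none (a : A) :
    absorb α (incl (A := withCopies A P ℕ) none a) =
      incl (A := withCopies A P ℕ) none (absorbLeft α a) :=
  lift_incl (A := withCopies A P ℕ) _ none a

theorem absorb_incl_zero (a : P) :
    absorb α (incl (A := withCopies A P ℕ) (some 0) a) =
      incl (A := withCopies A P ℕ) none (absorbRight α a) :=
  lift_incl (A := withCopies A P ℕ) _ (some 0) a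

theorem absorb_incl_succ (k : ℕ) (a : P) :
    absorb α (incl (A := withCopies A P ℕ) (some (k + 1)) a) =
      incl (A := withCopies A P ℕ) (some k) a :=
  lift_incl (A := withCopies A P ℕ) _ (some (k + 1)) a

/-- Both endomorphisms follow the same formulas on generators, so π intertwines them. This serves
both to compare kernels and to compute π of the lifted map. -/
theorem freeProductToTensor_absorb_pow (n : ℕ) (x : FreeProduct (withCopies A P ℕ)) :
    freeProductToTensor _ ((absorb α ^ n) x) =
      (MaxTensor.absorb α ^ n) (freeProductToTensor _ x) := by
  have h : (freeProductToTensor (withCopies A P ℕ)).comp (absorb α) =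
      (MaxTensor.absorb α).comp (freeProductToTensor (withCopies A P ℕ)) := by
    refine hom_ext fun i a => ?_
    change freeProductToTensor _ (absorb α _) = MaxTensor.absorb α (freeProductToTensor _ _)
    rw [freeProductToTensor_incl]
    rcases i with _ | _ | k
    · exact (congrArg _ (absorb_incl_none α a)).trans
        ((freeProductToTensor_incl _ _ _).trans (absorb_inclLeft α a).symm)
    · exact (congrArg _ (absorb_incl_zero α a)).trans
        ((freeProductToTensor_incl _ _ _).trans (absorb_inclRight_zero α a).symm)
    · exact (congrArg _ (absorb_incl_succ α k a)).trans
        ((freeProductToTensor_incl _ _ _).trans (absorb_inclRight_succ α k a).symm)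
  induction n with
  | zero => rfl
  | succ n ih =>
    rw [pow_succ', pow_succ']
    exact (DFunLike.congr_fun h _).trans (congrArg (MaxTensor.absorb α) ih)

end FreeProduct

end WithCopies

/-! ### Powers of the absorbing endomorphism kill the tensor relations -/

namespace FreeProduct

open MaxTensor

variable {A P : Type u} [CStarAlgebra A] [CStarAlgebra P]
  (α : MaxTensor (withCopies A P Unit) ≃⋆ₐ[ℂ] A)

theorem absorb_pow_succ (n : ℕ) (x : FreeProduct (withCopies A P ℕ)) :
    (absorb α ^ (n + 1)) x = (absorb α ^ n) (absorb α x) := by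
  rw [pow_succ]
  rfl

/-- After k shifts the k-th copy has become copy 0, while A has only moved within itself; the next
step puts P into A as `absorbRight`, which commutes with `absorbLeft`. Each shift replaces `a` by
`absorbLeft α a`, hence the generalization in the induction. -/
theorem absorb_pow_comm_none_some (k : ℕ) (a : A) (b : P) :
    (absorb α ^ (k + 1)) (incl (A := withCopies A P ℕ) none a) *
        (absorb α ^ (k + 1)) (incl (A := withCopies A P ℕ) (some k) b) =
      (absorb α ^ (k + 1)) (incl (A := withCopies A P ℕ) (some k) b) *
        (absorb α ^ (k + 1)) (incl (A := withCopies A P ℕ) none a) := by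
  induction k generalizing a with
  | zero =>
    simp only [zero_add, pow_one]
    rw [absorb_incl_none, absorb_incl_zero]
    have h := congrArg (incl (A := withCopies A P ℕ) none) (absorb_comm α a b)
    exact (map_mul _ _ _).symm.trans (h.trans (map_mul _ _ _))
  | succ k ih =>
    rw [absorb_pow_succ α (k + 1), absorb_pow_succ α (k + 1), absorb_incl_none, absorb_incl_succ]
    exact ih _

/-- The lower copy enters A after k + 1 steps, when the other has become copy l - k - 1. The
remaining l - k steps are just enough for the commutation of A with that copy. -/
theorem absorb_pow_comm_some_some {k l : ℕ} (h : k < l) (a b : P) :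
    (absorb α ^ (l + 1)) (incl (A := withCopies A P ℕ) (some k) a) *
        (absorb α ^ (l + 1)) (incl (A := withCopies A P ℕ) (some l) b) =
      (absorb α ^ (l + 1)) (incl (A := withCopies A P ℕ) (some l) b) *
        (absorb α ^ (l + 1)) (incl (A := withCopies A P ℕ) (some k) a) := by
  obtain ⟨l, rfl⟩ : ∃ m, l = m + 1 := ⟨l - 1, by omega⟩
  induction k generalizing l with
  | zero =>
    rw [absorb_pow_succ α (l + 1), absorb_pow_succ α (l + 1), absorb_incl_zero, absorb_incl_succ]
    exact absorb_pow_comm_none_some α l _ b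
  | succ k ih =>
    obtain ⟨l, rfl⟩ : ∃ m, l = m + 1 := ⟨l - 1, by omega⟩
    rw [absorb_pow_succ α (l + 1 + 1), absorb_pow_succ α (l + 1 + 1), absorb_incl_succ,
      absorb_incl_succ]
    exact ih l (by omega)

theorem absorb_pow_incl_none_one (n : ℕ) :
    (absorb α ^ n) (incl (A := withCopies A P ℕ) none (1 : A)) =
      incl (A := withCopies A P ℕ) none (1 : A) := by
  induction n with
  | zero => rfl
  | succ n ih => rw [absorb_pow_succ, absorb_incl_none, absorbLeft_one, ih]

/-- The k-th copy enters A at step k + 1 with its unit sent to that of A, which all later steps fix.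
-/
theorem absorb_pow_incl_some_one {k n : ℕ} (h : k < n) :
    (absorb α ^ n) (incl (A := withCopies A P ℕ) (some k) (1 : P)) =
      incl (A := withCopies A P ℕ) none (1 : A) := by
  obtain ⟨n, rfl⟩ : ∃ m, n = m + 1 := ⟨n - 1, by omega⟩
  induction k generalizing n with
  | zero =>
    rw [absorb_pow_succ, absorb_incl_zero, absorbRight_one, absorb_pow_incl_none_one]
  | succ k ih =>
    obtain ⟨n, rfl⟩ : ∃ m, n = m + 1 := ⟨n - 1, by omega⟩
    rw [absorb_pow_succ, absorb_incl_succ]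
    exact ih n (by omega)

/-- Every relation of the tensor product is annihilated by a power of `absorb`. -/
theorem exists_absorb_pow_eq_zero {r : FreeStarAlgebra (Σ i, withCopies A P ℕ i)}
    (hr : TensorRel (withCopies A P ℕ) r) :
    ∃ n, (absorb α ^ n) ((freeProductPresentation (withCopies A P ℕ)).toUniv r) = 0 := by
  cases hr with
  | comm i j hij a b =>
    suffices h : ∃ n, (absorb α ^ n) (incl i a) * (absorb α ^ n) (incl j b) =
        (absorb α ^ n) (incl j b) * (absorb α ^ n) (incl i a) by
      obtain ⟨n, hn⟩ := h
      refine ⟨n, ?_⟩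
      rw [map_sub, map_sub, sub_eq_zero, map_mul, map_mul, map_mul, map_mul]
      exact hn
    rcases i with _ | k <;> rcases j with _ | l
    · exact (hij rfl).elim
    · exact ⟨_, absorb_pow_comm_none_some α l a b⟩
    · exact ⟨_, (absorb_pow_comm_none_some α k b a).symm⟩
    · rcases lt_trichotomy k l with h | rfl | h
      · exact ⟨_, absorb_pow_comm_some_some α h a b⟩
      · exact (hij rfl).elim
      · exact ⟨_, (absorb_pow_comm_some_some α h b a).symm⟩
  | one i j =>
    -- The two units must be compared under one power, so equality is proved from a threshold on and
    -- the maximum is taken.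
    suffices h : ∀ i : Option ℕ, ∃ N, ∀ n ≥ N, (absorb α ^ n) (incl i 1) =
        incl (A := withCopies A P ℕ) none (1 : A) by
      obtain ⟨m, hm⟩ := h i
      obtain ⟨n, hn⟩ := h j
      refine ⟨max m n, ?_⟩
      rw [map_sub, map_sub, sub_eq_zero]
      exact (hm _ (le_max_left m n)).trans (hn _ (le_max_right m n)).symm
    rintro (_ | k)
    · exact ⟨0, fun n _ => absorb_pow_incl_none_one α n⟩
    · exact ⟨k + 1, fun n hn => absorb_pow_incl_some_one α hn⟩

/-- If Φ^n x = 0 then absorb^n(π x) = 0, and absorb is injective on the tensor product. -/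
theorem ker_absorb_pow_le (n : ℕ) :
    (ClosedIdeal.ker (absorb α ^ n)).toSubmodule ≤
      (ClosedIdeal.ker (freeProductToTensor (withCopies A P ℕ))).toSubmodule := by
  intro x hx
  rw [ClosedIdeal.mem_ker] at hx ⊢
  refine absorb_pow_injective α n ?_
  rw [← freeProductToTensor_absorb_pow, hx, map_zero, map_zero]

theorem ker_absorb_pow_monotone :
    Monotone fun n => (ClosedIdeal.ker (absorb α ^ n)).toSubmodule :=
  monotone_nat_of_le_succ fun n x hx => by
    rw [ClosedIdeal.mem_ker] at hx ⊢
    rw [pow_succ']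
    exact (congrArg (absorb α) hx).trans (map_zero _)

theorem ker_freeProductToTensor_eq :
    (ClosedIdeal.ker (freeProductToTensor (withCopies A P ℕ))).carrier =
      closure (⋃ n, (ClosedIdeal.ker (absorb α ^ n)).carrier) :=
  Set.Subset.antisymm
    (fun _ hx => mem_closure_iUnion_ker _ (absorb α) (fun _ => exists_absorb_pow_eq_zero α) hx)
    (closure_minimal (Set.iUnion_subset fun n => ker_absorb_pow_le α n)
      (ClosedIdeal.ker (freeProductToTensor (withCopies A P ℕ))).isClosed')

end FreeProduct

end

/-! ### The splitting -/

theorem mainTheorem3 (A P : Type u) [CStarAlgebra A] [CStarAlgebra P]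
    [SeparableSpace A] [SeparableSpace P]
    (hP : Nonempty (P ≃⋆ₐ[ℂ] MaxTensor (fun _ : ℕ => P)))
    (hA : IsSemiprojective A)
    (hAP : Nonempty (A ≃⋆ₐ[ℂ] MaxTensor (withCopies A P Unit))) :
    ∃ σ : MaxTensor (withCopies A P ℕ) →⋆ₙₐ[ℂ] FreeProduct (withCopies A P ℕ),
      (freeProductToTensor (withCopies A P ℕ)).comp σ = NonUnitalStarAlgHom.id ℂ _ := by
  obtain ⟨τ⟩ := hP
  obtain ⟨α'⟩ := hAP
  let α := α'.symm
  let π := freeProductToTensor (withCopies A P ℕ)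
  have hπ : Function.Surjective π := freeProductToTensor_surjective _
  -- Semiprojectivity is applied to A ≅ A ⊗ P^{⊗∞} ≅ Q / ker π and the ideals ker Φ^n.
  obtain ⟨n, ψ, hψ⟩ := hA.2 (FreeProduct (withCopies A P ℕ))
    (fun n => ClosedIdeal.ker (FreeProduct.absorb α ^ n)) (ClosedIdeal.ker π)
    (FreeProduct.ker_absorb_pow_monotone α) (FreeProduct.ker_freeProductToTensor_eq α)
    (FreeProduct.ker_absorb_pow_le α)
    ((ClosedIdeal.kerInv π hπ).comp (MaxTensor.expand α τ))
  -- `kerLift` is induced by Φ^n and not by a section of Q → Q / ker Φ^n. Hence the map A → Q lifts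
  -- `expand` only up to the twist absorb^n.
  have key (a : A) : π (ClosedIdeal.kerLift (FreeProduct.absorb α ^ n) (ψ a)) =
      (MaxTensor.absorb α ^ n) (MaxTensor.expand α τ a) := by
    obtain ⟨x, hx⟩ := (ClosedIdeal.ker (FreeProduct.absorb α ^ n)).mkQ_surjective (ψ a)
    obtain ⟨y, hy⟩ := hπ (MaxTensor.expand α τ a)
    have h : ClosedIdeal.factor (FreeProduct.ker_absorb_pow_le α n) (ψ a) =
        ClosedIdeal.kerInv π hπ (MaxTensor.expand α τ a) := hψ a
    rw [← hx, ClosedIdeal.factor_mkQ, ← hy, ClosedIdeal.kerInv_apply, ClosedIdeal.mkQ_ker_eq] at h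
    rw [← hx, ClosedIdeal.kerLift_mkQ, ← hy, ← h]
    exact FreeProduct.freeProductToTensor_absorb_pow α n x
  -- `contract` undoes `expand`, and unabsorb^n, applied first, cancels the twist.
  refine ⟨(((ClosedIdeal.kerLift (FreeProduct.absorb α ^ n)).comp ψ).comp
    (MaxTensor.contract α τ)).comp (MaxTensor.unabsorb α ^ n), NonUnitalStarAlgHom.ext fun y => ?_⟩
  refine (key _).trans ((congrArg _ (MaxTensor.expand_contract α τ _)).trans ?_)
  exact DFunLike.congr_fun (MaxTensor.absorb_pow_mul_unabsorb_pow α n) y
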